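/- Let $r,s\ge 1$ and let $W$ be a $\mathbb{Z}_2$-graded complex vector space of dimension $r|s$, with basis $e_1,\dots,e_r$ of even vectors and $f_1,\dots,f_s$ of odd vectors. Let $T(W)=\bigoplus_{n\ge 0}W^{\otimes n}$ be the tensor coalgebra (with the deconcatenation comultiplication), $C^n(W)=\operatorname{Hom}(W^{\otimes n},W)$ and $C(W)=\prod_{n\ge 0}C^n(W)=\operatorname{Hom}(T(W),W)$. A parity-homogeneous cochain $\psi\in C(W)$ determines the coderivation $\hat\psi$ of $T(W)$ given on words $w$ in the basis vectors by $$\hat\psi(w)=\sum_{w=uvt}(-1)^{|\psi||u|}\,u\otimes\psi(v)\otimes t,$$ where the sum is over all ways of writing $w$ as a concatenation of three (possibly empty) words. Put $\varphi\circ\psi=\varphi\hat\psi$ and $[\varphi,\psi]=\varphi\circ\psi-(-1)^{|\varphi||\psi|}\psi\circ\varphi$, extended bilinearly to $C(W)$. An odd cochain $d$ (equivalently, the odd coderivation $\hat d$) is called a codifferential if $[d,d]=0$; the coboundary operator of $d$ is $D=[d,\cdot\,]$. Let $d=\psi^{e_1e_1}_{f_s}\in C^2(W)$ be the cochain that sends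 $e_1\otimes e_1$ to $f_s$ and every other word in the basis vectors to $0$. Then $d$ is a codifferential, and for every $n\ge 0$ its cohomology $$H^n=\ker\bigl(D:C^n(W)\to C^{n+1}(W)\bigr)\big/ D\bigl(C^{n-1}(W)\bigr)\qquad (C^{-1}(W)=0)$$ has dimension $$\dim H^n=\begin{cases}(r+s-1)^{n+1}, & n\equiv 0,1 \pmod 4,\\ (r+s-1)^{n+1}+1, & n\equiv 2,3\pmod 4.\end{cases}$$ -/

import Mathlib

open scoped TensorProduct

noncomputable section

namespace TensorCoalg

variable {r s : ℕ} {W : Type*} [AddCommGroup W] [Module ℂ W]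

/-- Parity of a basis letter of an `r|s`-dimensional space: the letters `Sum.inl i` index the
even basis vectors `e_i`, the letters `Sum.inr j` index the odd basis vectors `f_j`. -/
def letterParity : Fin r ⊕ Fin s → ZMod 2 :=
  Sum.elim (fun _ => 0) (fun _ => 1)

/-- Parity of a word (multi-index): the sum of the parities of its letters. -/
def wordParity (w : List (Fin r ⊕ Fin s)) : ZMod 2 :=
  (w.map letterParity).sum

/-- The sign `(-1)^{pq}`. -/
def sign (p q : ZMod 2) : ℂ := (-1) ^ (p.val * q.val)

/-- The element `w_1 ⊗ ⋯ ⊗ w_n` of the tensor algebra attached to a word in the basis letters.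
These elements form a basis of `T(W) = ⨁ₙ Wᵗⁿ`, `n ≥ 0`. -/
def word (b : Module.Basis (Fin r ⊕ Fin s) ℂ W) (w : List (Fin r ⊕ Fin s)) :
    TensorAlgebra ℂ W :=
  b.tensorAlgebra (FreeMonoid.ofList w)

/-- The linear map out of `T(W)` with prescribed values on words. -/
def onWords (b : Module.Basis (Fin r ⊕ Fin s) ℂ W) {M : Type*} [AddCommGroup M] [Module ℂ M]
    (F : List (Fin r ⊕ Fin s) → M) : TensorAlgebra ℂ W →ₗ[ℂ] M :=
  b.tensorAlgebra.constr ℂ (fun w => F w.toList)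

theorem onWords_word (b : Module.Basis (Fin r ⊕ Fin s) ℂ W) {M : Type*} [AddCommGroup M]
    [Module ℂ M] (F : List (Fin r ⊕ Fin s) → M) (w : List (Fin r ⊕ Fin s)) :
    onWords b F (word b w) = F w := by
  simp [onWords, word, Module.Basis.constr_basis]

theorem ext_words (b : Module.Basis (Fin r ⊕ Fin s) ℂ W) {M : Type*} [AddCommGroup M]
    [Module ℂ M] {F G : TensorAlgebra ℂ W →ₗ[ℂ] M}
    (h : ∀ w, F (word b w) = G (word b w)) : F = G :=
  b.tensorAlgebra.ext (fun w => h w.toList)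

/-- The space of cochains `C(W) = Hom(T(W), W) = ∏ₙ Hom(Tⁿ(W), W)`. -/
abbrev Cochain (W : Type*) [AddCommGroup W] [Module ℂ W] : Type _ :=
  TensorAlgebra ℂ W →ₗ[ℂ] W

/-- The basic cochain `φ^I_i`, which sends the word `I` to the basis vector `i` and every other
word to `0`. -/
def basicCochain (b : Module.Basis (Fin r ⊕ Fin s) ℂ W) (I : List (Fin r ⊕ Fin s))
    (i : Fin r ⊕ Fin s) : Cochain W :=
  onWords b (fun w => if w = I then b i else 0)

/-- Projection of `W` onto its part of parity `p`. -/
def parityProj (b : Module.Basis (Fin r ⊕ Fin s) ℂ W) (p : ZMod 2) : W →ₗ[ℂ] W :=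
  b.constr ℂ (fun x => if letterParity x = p then b x else 0)

/-- The component of parity `p` of a cochain: on a word of parity `q`, keep the part of the value
that has parity `p + q`. -/
def component (b : Module.Basis (Fin r ⊕ Fin s) ℂ W) (p : ZMod 2) : Cochain W →ₗ[ℂ] Cochain W where
  toFun φ := onWords b (fun w => parityProj b (p + wordParity w) (φ (word b w)))
  map_add' φ ψ := ext_words b (fun w => by simp [onWords_word])
  map_smul' c φ := ext_words b (fun w => by simp [onWords_word])

/-- The coderivation of `T(W)` determined by a cochain `φ`. For `φ` of parity `p` it sends a word
to the sum of `(-1)^{p|u|} u ⊗ φ(v) ⊗ t` over all ways of writing the word as a concatenation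
`u v t` (`v` may be empty); it is extended linearly to inhomogeneous `φ`. -/
def coderivation (b : Module.Basis (Fin r ⊕ Fin s) ℂ W) :
    Cochain W →ₗ[ℂ] (TensorAlgebra ℂ W →ₗ[ℂ] TensorAlgebra ℂ W) where
  toFun φ := onWords b (fun w =>
    ∑ p : ZMod 2, ∑ i ∈ Finset.range (w.length + 1), ∑ j ∈ Finset.range (w.length - i + 1),
      sign p (wordParity (w.take i)) •
        (word b (w.take i) *
          TensorAlgebra.ι ℂ (component b p φ (word b ((w.drop i).take j))) *
          word b (w.drop (i + j))))
  map_add' φ ψ := ext_words b (fun w => by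
    simp only [onWords_word, map_add, LinearMap.add_apply, mul_add, add_mul, smul_add,
      Finset.sum_add_distrib])
  map_smul' c φ := ext_words b (fun w => by
    simp only [onWords_word, map_smul, LinearMap.smul_apply, mul_smul_comm, smul_mul_assoc,
      Finset.smul_sum, RingHom.id_apply, smul_comm c])

/-- Composition of cochains, `φ ∘ ψ = ∑ ± φ(1 ⊗ ⋯ ⊗ ψ ⊗ ⋯ ⊗ 1)`. -/
def circ (b : Module.Basis (Fin r ⊕ Fin s) ℂ W) (φ ψ : Cochain W) : Cochain W :=
  φ ∘ₗ coderivation b ψ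

/-- The graded Lie bracket `[φ, ψ] = φ ∘ ψ - (-1)^{|φ||ψ|} ψ ∘ φ` on `C(W)`, extended bilinearly
from homogeneous cochains. As a function of `ψ` it is linear. -/
def bracket (b : Module.Basis (Fin r ⊕ Fin s) ℂ W) (φ : Cochain W) : Cochain W →ₗ[ℂ] Cochain W where
  toFun ψ := ∑ p : ZMod 2, ∑ q : ZMod 2,
    (circ b (component b p φ) (component b q ψ)
      - sign p q • circ b (component b q ψ) (component b p φ))
  map_add' ψ χ := by
    simp only [circ, map_add, LinearMap.add_comp, LinearMap.comp_add, smul_add, add_sub_add_comm,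
      Finset.sum_add_distrib]
  map_smul' c ψ := by
    simp only [circ, map_smul, LinearMap.smul_comp, LinearMap.comp_smul, smul_sub,
      Finset.smul_sum, RingHom.id_apply, smul_comm c]

/-- The deconcatenation comultiplication of the tensor coalgebra `T(W)`. -/
def comul (b : Module.Basis (Fin r ⊕ Fin s) ℂ W) :
    TensorAlgebra ℂ W →ₗ[ℂ] TensorAlgebra ℂ W ⊗[ℂ] TensorAlgebra ℂ W :=
  onWords b (fun w => ∑ i ∈ Finset.range (w.length + 1),
    word b (w.take i) ⊗ₜ[ℂ] word b (w.drop i))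

/-- The involution `x ↦ (-1)^{|x|} x` of `T(W)`. -/
def parityInvolution (b : Module.Basis (Fin r ⊕ Fin s) ℂ W) :
    TensorAlgebra ℂ W →ₗ[ℂ] TensorAlgebra ℂ W :=
  onWords b (fun w => sign 1 (wordParity w) • word b w)

/-- The cochain `d` is a codifferential: it is odd, the map `δ` that it determines on the tensor
coalgebra is a coderivation, `Δ δ = (δ ⊗ 1 + 1 ⊗ δ) Δ` with the Koszul sign
`(1 ⊗ δ)(x ⊗ y) = (-1)^{|x|} x ⊗ δ y`, and `[d, d] = 0`. -/
structure IsCodifferential (b : Module.Basis (Fin r ⊕ Fin s) ℂ W) (d : Cochain W) : Prop where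
  odd : component b 1 d = d
  coderivation : comul b ∘ₗ coderivation b d =
    (TensorProduct.map (coderivation b d) LinearMap.id
      + TensorProduct.map (parityInvolution b) (coderivation b d)) ∘ₗ comul b
  bracket_self : bracket b d d = 0

/-- The `n`-cochains `Cⁿ(W) = Hom(Tⁿ(W), W)`, as the cochains that vanish on all words of length
other than `n`. -/
def cochains (b : Module.Basis (Fin r ⊕ Fin s) ℂ W) (n : ℕ) : Submodule ℂ (Cochain W) where
  carrier := {φ | ∀ w, w.length ≠ n → φ (word b w) = 0}
  zero_mem' _ _ := rfl
  add_mem' hφ hψ w hw := by simp [hφ w hw, hψ w hw]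
  smul_mem' c φ hφ w hw := by simp [hφ w hw]

/-- The `n`-cocycles of the coboundary operator `D = [d, ·]`. -/
def cocycles (b : Module.Basis (Fin r ⊕ Fin s) ℂ W) (d : Cochain W) (n : ℕ) :
    Submodule ℂ (Cochain W) :=
  cochains b n ⊓ LinearMap.ker (bracket b d)

/-- The `n`-coboundaries `D(Cⁿ⁻¹(W))` of a quadratic `d`; there are none for `n = 0`. -/
def coboundaries (b : Module.Basis (Fin r ⊕ Fin s) ℂ W) (d : Cochain W) :
    ℕ → Submodule ℂ (Cochain W)
  | 0 => ⊥
  | n + 1 => (cochains b n).map (bracket b d)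

/-- The cohomology `Hⁿ` of a quadratic codifferential `d`, cocycles modulo coboundaries. -/
abbrev Cohomology (b : Module.Basis (Fin r ⊕ Fin s) ℂ W) (d : Cochain W) (n : ℕ) : Type _ :=
  cocycles b d n ⧸ (coboundaries b d n).submoduleOf (cocycles b d n)

end TensorCoalg

end

/-! Put N = r + s, x = e_1, f = f_s, and describe a cochain φ by its coefficient functions a_i on
words, one for each letter i. A function on words is a noncommutative power series. In each
coefficient, φ ↦ φ ∘ d becomes the signed derivation ∂ = `bd` of power series with ∂f = xx and ∂z =
0 for the other letters z, while d ∘ φ contributes only {x, a_x} = x a_x + a_x x, in the coefficient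
of f. Up to the signs in `twist`, Dφ = 0 says that ∂a_i = 0 for i ≠ f and ∂a_f = {x, a_x}
(`coef_bracket`, `mem_cocyc`).

The values of a cycle of ∂ on good words can be prescribed, and they determine it modulo boundaries
(`exists_cycle`, `exists_bd_eq`); the mechanism is that fx - xf is a cycle. There are (N-1)^n good
words of length n (`cnt_good`).

A cycle a_x occurs in a cocycle iff {x, a_x} is a boundary, so the rank ρ_n of {x, ·} from length n
to length n + 1 on the cohomology of ∂ is needed. Left multiplication by x prepends x to good words;
right multiplication changes only the end of a word (`rmul_eq_endMul`), so the two usually do not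
interfere and the rank is the number g_{n+1} of good words of length n + 1 starting with x. The
exception is x(fx)^k with n = 2k, where the two agree up to (-1)^k and {x, ·} acquires the factor 1
+ (-1)^k. Hence ρ_n = g_{n+1} - [n ≡ 2 mod 4].

Now dim Z^n = N dim ker ∂_n - ρ_n (`finrank_cocyc`) and g_{n+1} + g_n = (N-1)^n, so rank-nullity
gives, for n ≥ 1, dim H^n = N (N-1)^n - ρ_n - ρ_{n-1} = (N-1)^{n+1} + [n ≡ 2] + [n ≡ 3] modulo 4. -/

namespace WordComplex

/-! ### Good words and functions on words -/

variable {L : Type*}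

/-- The letters have signs, `x` is even and `f` is odd. -/
structure Signs (ε : L → ℂ) (x f : L) : Prop where
  sq : ∀ z, ε z * ε z = 1
  even : ε x = 1
  odd : ε f = -1

theorem Signs.ne {ε : L → ℂ} {x f : L} (h : Signs ε x f) : f ≠ x := by
  rintro rfl
  have := h.even.symm.trans h.odd
  norm_num at this

theorem Signs.ne_zero {ε : L → ℂ} {x f : L} (h : Signs ε x f) (z : L) : ε z ≠ 0 := by
  intro h0
  simpa [h0] using h.sq z

/-- Words without `x x` in which every `f` is followed by `x`. -/
def Good (x f : L) : List L → Prop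
  | [] => True
  | z :: w => Good x f w ∧ (z = x → w.head? ≠ some x) ∧ (z = f → w.head? = some x)

theorem Good.cons_left {x f : L} (h : f ≠ x) {w : List L} (hw : Good x f w)
    (hx : w.head? ≠ some x) : Good x f (x :: w) :=
  ⟨hw, fun _ => hx, fun h' => absurd h'.symm h⟩

theorem Good.cons_odd {x f : L} (h : f ≠ x) {w : List L} (hw : Good x f w)
    (hx : w.head? = some x) : Good x f (f :: w) :=
  ⟨hw, fun h' => absurd h' h, fun _ => hx⟩

theorem Good.cons_of_ne {x f z : L} (hx : z ≠ x) (hf : z ≠ f) {w : List L} (hw : Good x f w) :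
    Good x f (z :: w) :=
  ⟨hw, fun h' => absurd h' hx, fun h' => absurd h' hf⟩

/-- The functions supported on the words of length `n` with the property `Q`. -/
def supp (Q : List L → Prop) (n : ℕ) : Submodule ℂ (List L → ℂ) where
  carrier := {a | ∀ w, ¬(Q w ∧ w.length = n) → a w = 0}
  zero_mem' _ _ := rfl
  add_mem' ha hb w hw := by simp [ha w hw, hb w hw]
  smul_mem' c a ha w hw := by simp [ha w hw]

/-- The functions supported on the words of length `n`. -/
abbrev hom (L : Type*) (n : ℕ) : Submodule ℂ (List L → ℂ) := supp (fun _ => True) n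

theorem mem_hom {n : ℕ} {a : List L → ℂ} : a ∈ hom L n ↔ ∀ w, w.length ≠ n → a w = 0 := by
  simp [supp]

/-- The function with prescribed restrictions to the words with given first letter. -/
def glue (A : L → List L → ℂ) : List L → ℂ
  | [] => 0
  | z :: w => A z w

/-! ### Multiplication by a letter and the derivation with f ↦ x x -/

variable [DecidableEq L]

/-- The transpose of deleting the first letter `x`: left multiplication by the letter `x`. -/
def lmul (x : L) : (List L → ℂ) →ₗ[ℂ] (List L → ℂ) where
  toFun a w := match w with
    | [] => 0
    | z :: w => if z = x then a w else 0
  map_add' a b := by funext w; cases w <;> simp; split_ifs <;> simp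
  map_smul' c a := by funext w; cases w <;> simp

@[simp] theorem lmul_nil (x : L) (a : List L → ℂ) : lmul x a [] = 0 := rfl

@[simp] theorem lmul_cons (x z : L) (a : List L → ℂ) (w : List L) :
    lmul x a (z :: w) = if z = x then a w else 0 := rfl

/-- Right multiplication by the letter `x`. -/
def rmul (x : L) : (List L → ℂ) →ₗ[ℂ] (List L → ℂ) where
  toFun a w := if w.getLast? = some x then a w.dropLast else 0
  map_add' a b := by funext w; simp only [Pi.add_apply]; split_ifs <;> simp
  map_smul' c a := by funext w; simp

theorem rmul_apply (x : L) (a : List L → ℂ) (w : List L) :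
    rmul x a w = if w.getLast? = some x then a w.dropLast else 0 := rfl

@[simp] theorem rmul_nil (x : L) (a : List L → ℂ) : rmul x a [] = 0 := by simp [rmul_apply]

theorem rmul_append (x : L) (a : List L → ℂ) (w : List L) : rmul x a (w ++ [x]) = a w := by
  simp [rmul_apply]

theorem rmul_singleton (x z : L) (a : List L → ℂ) :
    rmul x a [z] = if z = x then a [] else 0 := by simp [rmul_apply]

theorem rmul_cons_cons (x z y : L) (a : List L → ℂ) (w : List L) :
    rmul x a (z :: y :: w) = rmul x (fun u => a (z :: u)) (y :: w) := by
  simp [rmul_apply, List.getLast?_cons_cons]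

/-- Values on words of the coboundary `a ↦ ∑ ± a(u f t)`, the sum over the factorizations
`u x x t` of a word. -/
def bdFun (ε : L → ℂ) (x f : L) : List L → (List L → ℂ) → ℂ
  | [], _ => 0
  | z :: w, a => ε z * bdFun ε x f w (fun u => a (z :: u)) +
      if z = x then lmul x (fun u => a (f :: u)) w else 0

theorem bdFun_add (ε : L → ℂ) (x f : L) (w : List L) (a b : List L → ℂ) :
    bdFun ε x f w (a + b) = bdFun ε x f w a + bdFun ε x f w b := by
  induction w generalizing a b with
  | nil => simp [bdFun]
  | cons z w ih =>
    have h1 := ih (fun u => a (z :: u)) (fun u => b (z :: u))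
    have h2 := congrFun ((lmul x).map_add (fun u => a (f :: u)) (fun u => b (f :: u))) w
    simp only [bdFun]
    simp only [Pi.add_def] at h1 h2 ⊢
    rw [h1, h2]
    split_ifs <;> ring

theorem bdFun_smul (ε : L → ℂ) (x f : L) (w : List L) (c : ℂ) (a : List L → ℂ) :
    bdFun ε x f w (c • a) = c * bdFun ε x f w a := by
  induction w generalizing a with
  | nil => simp [bdFun]
  | cons z w ih =>
    have h1 := ih (fun u => a (z :: u))
    have h2 := congrFun ((lmul x).map_smul c (fun u => a (f :: u))) w
    simp only [bdFun]
    simp only [Pi.smul_def, smul_eq_mul] at h1 h2 ⊢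
    rw [h1, h2]
    split_ifs <;> ring

/-- The coboundary on functions on words, transpose to the derivation of the tensor algebra
with `f ↦ x x` killing the other letters. -/
def bd (ε : L → ℂ) (x f : L) : (List L → ℂ) →ₗ[ℂ] (List L → ℂ) where
  toFun a w := bdFun ε x f w a
  map_add' a b := by funext w; exact bdFun_add ε x f w a b
  map_smul' c a := by funext w; exact bdFun_smul ε x f w c a

@[simp] theorem bd_nil (ε : L → ℂ) (x f : L) (a : List L → ℂ) : bd ε x f a [] = 0 := rfl

theorem bd_cons (ε : L → ℂ) (x f z : L) (a : List L → ℂ) (w : List L) :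
    bd ε x f a (z :: w) = ε z * bd ε x f (fun u => a (z :: u)) w +
      if z = x then lmul x (fun u => a (f :: u)) w else 0 := rfl

theorem bd_eq_zero_of_mem (ε : L → ℂ) (x f : L) {a : List L → ℂ} (h : ∀ u, f ∈ u → a u = 0) :
    bd ε x f a = 0 := by
  funext w
  induction w generalizing a with
  | nil => rfl
  | cons z w ih =>
    rw [bd_cons, ih (fun u hu => h _ (List.mem_cons_of_mem _ hu))]
    have : lmul x (fun u => a (f :: u)) = 0 := by
      funext v
      cases v <;> simp [h]
    simp [this]

theorem bd_lmul_left {ε : L → ℂ} {x f : L} (h : Signs ε x f) (a : List L → ℂ) :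
    bd ε x f (lmul x a) = lmul x (bd ε x f a) := by
  funext w
  cases w with
  | nil => rfl
  | cons z w =>
    have h2 : (fun u => lmul x a (f :: u)) = 0 := by funext u; simp [h.ne]
    rw [bd_cons, h2]
    by_cases hz : z = x
    · subst hz; simp [h.even]
    · have h1 : (fun u => lmul x a (z :: u)) = 0 := by funext u; simp [hz]
      rw [h1]
      simp [hz]

/-- The graded Leibniz rule for f a; the minus sign is the parity of f. -/
theorem bd_lmul_odd {ε : L → ℂ} {x f : L} (h : Signs ε x f) (a : List L → ℂ) :
    bd ε x f (lmul f a) = lmul x (lmul x a) - lmul f (bd ε x f a) := by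
  funext w
  cases w with
  | nil => simp
  | cons z w =>
    have h2 : (fun u => lmul f a (f :: u)) = a := by funext u; simp
    rw [bd_cons, h2]
    by_cases hz : z = f
    · subst hz
      simp [h.odd, h.ne]
    · have h1 : (fun u => lmul f a (z :: u)) = 0 := by funext u; simp [hz]
      rw [h1]
      simp [hz]

/-- By induction on the first letter: for the letter x the two cross terms cancel, because ∂ passes
x without a sign and passes f with a minus sign. -/
theorem bd_bd {ε : L → ℂ} {x f : L} (h : Signs ε x f) (a : List L → ℂ) :
    bd ε x f (bd ε x f a) = 0 := by
  funext w
  induction w generalizing a with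
  | nil => rfl
  | cons z w ih =>
    have h2 : (fun u => bd ε x f a (f :: u)) = - bd ε x f (fun u => a (f :: u)) := by
      funext u; simp [bd_cons, h.ne, h.odd]
    have h1 : (fun u => bd ε x f a (z :: u)) = ε z • bd ε x f (fun u => a (z :: u)) +
        if z = x then lmul x (fun u => a (f :: u)) else 0 := by
      funext u; rw [bd_cons]; split_ifs <;> simp
    rw [bd_cons, h1, h2, map_add, map_smul]
    simp only [Pi.add_apply, Pi.smul_apply, ih]
    split_ifs with hz
    · subst hz
      simp [bd_lmul_left h, h.even]
    · simp

theorem bd_rmul {ε : L → ℂ} {x f : L} (h : Signs ε x f) (a : List L → ℂ) :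
    bd ε x f (rmul x a) = rmul x (bd ε x f a) := by
  funext w
  induction w generalizing a with
  | nil => simp
  | cons z w ih =>
    -- Shifting by a first letter commutes with right multiplication except at the empty word; the
    -- correction involves no word containing f, so ∂ kills it.
    have h1 : ∀ z, (fun u => rmul x a (z :: u)) = rmul x (fun u => a (z :: u)) +
        fun u => if u = [] ∧ z = x then a [] else 0 := by
      intro z
      funext u
      cases u with
      | nil => simp [rmul_singleton]
      | cons y u => simp [rmul_cons_cons]
    have h3 : bd ε x f (fun u => if u = [] ∧ z = x then a [] else 0) = 0 := by
      apply bd_eq_zero_of_mem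
      intro u hu
      rw [if_neg]
      rintro ⟨rfl, -⟩
      simp at hu
    have h4 : (fun u : List L => if u = [] ∧ f = x then a [] else 0) = 0 := by
      funext u; simp [h.ne]
    rw [bd_cons, h1 z, h1 f, map_add, h3, h4, add_zero, add_zero, ih]
    cases w with
    | nil => simp [rmul_singleton, bd]; intro; simp [bdFun]
    | cons y w =>
      rw [rmul_cons_cons]
      have h5 : (fun u => bd ε x f a (z :: u)) = ε z • bd ε x f (fun u => a (z :: u)) +
        if z = x then lmul x (fun u => a (f :: u)) else 0 := by
        funext u; rw [bd_cons]; split_ifs <;> simp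
      rw [h5, map_add, map_smul]
      simp only [Pi.add_apply, Pi.smul_apply, smul_eq_mul]
      congr 1
      split_ifs with hz
      · cases w with
        | nil => simp [rmul_singleton]
        | cons v w =>
          rw [rmul_cons_cons]
          simp only [lmul_cons]
          split_ifs
          · rfl
          · exact congrFun (map_zero (rmul x)).symm _
      · simp

/-! ### Good words classify cycles modulo coboundaries -/

theorem lmul_apply_of_head?_ne {x : L} (a : List L → ℂ) {w : List L} (h : w.head? ≠ some x) :
    lmul x a w = 0 := by
  cases w with
  | nil => rfl
  | cons z w =>
    have : z ≠ x := by simpa using h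
    simp [this]

/-- A good word has no factor x x, so the sum defining the coboundary is empty. -/
theorem bd_apply_of_good (ε : L → ℂ) {x f : L} (a : List L → ℂ) {w : List L} (hw : Good x f w) :
    bd ε x f a w = 0 := by
  induction w generalizing a with
  | nil => rfl
  | cons z w ih =>
    rw [bd_cons, ih _ hw.1]
    split_ifs with hz
    · simp [lmul_apply_of_head?_ne _ (hw.2.1 hz)]
    · simp

/-- The cycle is built recursively as x b + (f x - x f) e + ∑ z A_z over the letters z ≠ x, f, with
b, e and A_z shorter cycles. It is a cycle because f x - x f is one. -/
theorem exists_cycle {ε : L → ℂ} {x f : L} (h : Signs ε x f) (n : ℕ) (g : List L → ℂ) :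
    ∃ a ∈ hom L n, bd ε x f a = 0 ∧ ∀ w, Good x f w → w.length = n → a w = g w := by
  induction n using Nat.strong_induction_on generalizing g with
  | _ n ih =>
  cases n with
  | zero =>
    refine ⟨fun w => if w = [] then g [] else 0, ?_, ?_, ?_⟩
    · rw [mem_hom]; intro w hw; rw [if_neg]; rintro rfl; simp at hw
    · apply bd_eq_zero_of_mem
      intro u hu
      rw [if_neg]
      rintro rfl
      simp at hu
    · intro w _ hw
      simp [List.length_eq_zero_iff.1 hw]
  | succ n =>
    obtain ⟨e, he, hbe, hge⟩ : ∃ e : List L → ℂ, (∀ w, w.length + 1 ≠ n → e w = 0) ∧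
        bd ε x f e = 0 ∧ ∀ w, Good x f w → w.length + 1 = n → e w = g (f :: x :: w) := by
      cases n with
      | zero => exact ⟨0, by simp, by simp, by simp⟩
      | succ m =>
        obtain ⟨e, he, hbe, hge⟩ := ih m (by omega) (fun w => g (f :: x :: w))
        rw [mem_hom] at he
        exact ⟨e, fun w hw => he w (by simpa using hw), hbe,
          fun w hw hl => hge w hw (by simpa using hl)⟩
    -- The added term compensates for the part -x f e of the cycle on words starting with x.
    obtain ⟨b, hb, hbb, hgb⟩ := ih n (by omega) (fun w => g (x :: w) + lmul f e w)
    choose A hA hbA hgA using fun z => ih n (by omega) (fun w => g (z :: w))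
    simp only [mem_hom] at hb hA
    have hl : ∀ y w, w.length ≠ n → lmul y e w = 0 := by
      intro y w hw
      cases w with
      | nil => rfl
      | cons z w =>
        have := he w (by simpa using hw)
        simp [this]
    refine ⟨glue (fun z => if z = x then b - lmul f e else if z = f then lmul x e else A z),
      ?_, ?_, ?_⟩
    · rw [mem_hom]
      rintro (_ | ⟨z, w⟩) hw
      · rfl
      · have hw' : w.length ≠ n := by simpa using hw
        simp only [glue]
        split_ifs
        · simp [hb w hw', hl _ w hw']
        · exact hl _ w hw'
        · exact hA z w hw'
    · funext w
      cases w with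
      | nil => rfl
      | cons z w =>
        rw [bd_cons]
        simp only [glue, if_true, h.ne, if_false]
        by_cases hz : z = x
        · subst hz
          simp only [if_true]
          change ε z * bd ε z f (b - lmul f e) w + lmul z (lmul z e) w = _
          rw [map_sub, bd_lmul_odd h, hbb, hbe, h.even]
          simp
        · by_cases hf : z = f
          · subst hf
            simp only [hz, if_false, if_true]
            change ε z * bd ε x z (lmul x e) w + 0 = 0
            rw [bd_lmul_left h, hbe]
            simp
          · simp only [hz, hf, if_false]
            change ε z * bd ε x f (A z) w + 0 = 0
            rw [hbA]
            simp
    · rintro (_ | ⟨z, w⟩) hg hw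
      · simp at hw
      have hw' : w.length = n := by simpa using hw
      simp only [glue]
      split_ifs with hz hf
      · subst hz
        simp [hgb w hg.1 hw']
      · subst hf
        cases w with
        | nil => simpa using hg.2.2 rfl
        | cons y w =>
          have hy : y = x := by simpa using hg.2.2 rfl
          subst hy
          simpa using hge w hg.1.1 (by simpa using hw')
      · exact hgA z w hg.1 hw'

/-- Induction on the length, splitting a by its first letter. The support is expressed with
`w.length + 1` so that for n = 0 the primitive is forced to vanish. -/
theorem exists_bd_eq {ε : L → ℂ} {x f : L} (h : Signs ε x f) (n : ℕ) {a : List L → ℂ}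
    (ha : a ∈ hom L n) (hbd : bd ε x f a = 0) (hg : ∀ w, Good x f w → a w = 0) :
    ∃ a' : List L → ℂ, (∀ w, w.length + 1 ≠ n → a' w = 0) ∧ bd ε x f a' = a := by
  induction n generalizing a with
  | zero =>
    refine ⟨0, by simp, ?_⟩
    rw [map_zero]
    funext w
    cases w with
    | nil => exact (hg [] trivial).symm
    | cons z w => exact (mem_hom.1 ha _ (by simp)).symm
  | succ n ih =>
    rw [mem_hom] at ha
    have hs : ∀ z, (fun u => a (z :: u)) ∈ hom L n := fun z =>
      mem_hom.2 fun w hw => ha _ (by simpa using hw)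
    have hbd' : ∀ z w, ε z * bd ε x f (fun u => a (z :: u)) w +
        (if z = x then lmul x (fun u => a (f :: u)) w else 0) = 0 := fun z w =>
      (bd_cons ε x f z a w).symm.trans (congrFun hbd _)
    have hne : ∀ z, z ≠ x → bd ε x f (fun u => a (z :: u)) = 0 := by
      intro z hz
      funext w
      have := hbd' z w
      simpa [hz, h.ne_zero] using this
    have hbx : bd ε x f (fun u => a (x :: u)) = - lmul x (fun u => a (f :: u)) := by
      funext w
      have := hbd' x w
      simp only [h.even, if_true, one_mul] at this
      exact eq_neg_of_add_eq_zero_left this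
    have hoth : ∀ z, ∃ a' : List L → ℂ, z ≠ x → z ≠ f → (∀ w, w.length + 1 ≠ n → a' w = 0) ∧
        bd ε x f a' = fun u => a (z :: u) := by
      intro z
      by_cases hz : z = x
      · exact ⟨0, fun h' => absurd hz h'⟩
      by_cases hf : z = f
      · exact ⟨0, fun _ h' => absurd hf h'⟩
      obtain ⟨a', h1, h2⟩ := ih (hs z) (hne z hz) (fun w hw => hg _ (hw.cons_of_ne hz hf))
      exact ⟨a', fun _ _ => ⟨h1, h2⟩⟩
    choose A hA using hoth
    obtain ⟨c, hc, hbc⟩ := ih (hs f) (hne f h.ne) (by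
      intro w hw
      by_cases hx : w.head? = some x
      · exact hg _ (hw.cons_odd h.ne hx)
      -- If w does not start with x, then x w is good. A coboundary vanishes there, and ∂a_x = -x
      -- a_f then forces a (f w) = 0.
      · have h1 := congrFun hbx (x :: w)
        rw [bd_apply_of_good ε _ (hw.cons_left h.ne hx)] at h1
        simpa using h1)
    have hlc : ∀ y (c : List L → ℂ), (∀ w, w.length + 1 ≠ n → c w = 0) → lmul y c ∈ hom L n := by
      intro y c hc
      rw [mem_hom]
      intro w hw
      cases w with
      | nil => rfl
      | cons z w =>
        have := hc w (by simpa using hw)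
        simp [this]
    -- The cycle a_x + x c may be nonzero on good words starting with x. The primitive c of a_f is
    -- only determined up to a cycle, and e is the cycle that removes these values.
    obtain ⟨e, he, hbe, hge⟩ : ∃ e : List L → ℂ, (∀ w, w.length + 1 ≠ n → e w = 0) ∧
        bd ε x f e = 0 ∧ ∀ w, Good x f w → w.head? ≠ some x → w.length + 1 = n →
          e w = a (x :: x :: w) + c w := by
      cases n with
      | zero => exact ⟨0, by simp, by simp, by simp⟩
      | succ m =>
        obtain ⟨e, he, hbe, hge⟩ := exists_cycle h m (fun w => a (x :: x :: w) + c w)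
        rw [mem_hom] at he
        exact ⟨e, fun w hw => he w (by simpa using hw), hbe,
          fun w hw _ hl => hge w hw (by simpa using hl)⟩
    obtain ⟨b, hb, hbb⟩ := ih (a := (fun u => a (x :: u)) + lmul x c - lmul x e)
      (sub_mem (add_mem (hs x) (hlc x c hc)) (hlc x e he))
      (by rw [map_sub, map_add, hbx, bd_lmul_left h, bd_lmul_left h, hbc, hbe]; simp)
      (by
        intro w hw
        by_cases hx : w.head? = some x
        · cases w with
          | nil => simp at hx
          | cons z w =>
            have hz : z = x := by simpa using hx
            subst hz
            by_cases hl : w.length + 1 = n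
            · simp [hge w hw.1 (hw.2.1 rfl) hl]
            · simp [he w hl, hc w hl, ha (z :: z :: w) (by simpa using hl)]
        · simp [lmul_apply_of_head?_ne _ hx, hg _ (hw.cons_left h.ne hx)])
    -- On the f part the sign of f turns -∂c into a_f; on the x part, ∂b + x (e - c) = a_x.
    refine ⟨glue (fun z => if z = x then b else if z = f then e - c else ε z • A z), ?_, ?_⟩
    · rintro (_ | ⟨z, w⟩) hw
      · rfl
      · have hw' : w.length + 1 ≠ n := by simpa using hw
        simp only [glue]
        split_ifs with hz hf
        · exact hb w hw'
        · simp [he w hw', hc w hw']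
        · simp [(hA z hz hf).1 w hw']
    · funext w
      cases w with
      | nil => exact (hg [] trivial).symm
      | cons z w =>
        rw [bd_cons]
        simp only [glue, if_true, h.ne, if_false]
        by_cases hz : z = x
        · subst hz
          simp only [if_true, h.even, one_mul]
          change bd ε z f b w + lmul z (e - c) w = _
          rw [hbb, map_sub]
          simp
        · by_cases hf : z = f
          · subst hf
            simp only [hz, if_false, if_true]
            change ε z * bd ε x z (e - c) w + 0 = _
            rw [map_sub, hbe, hbc, h.odd]
            simp
          · simp only [hz, hf, if_false]
            change ε z * bd ε x f (ε z • A z) w + 0 = _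
            rw [map_smul, (hA z hz hf).2, Pi.smul_apply, smul_eq_mul, ← mul_assoc, h.sq]
            simp


/-! ### The anticommutator with x on cohomology classes -/

section Pure

variable {L : Type*}

/-- The words in the letters `x` and `f` only. -/
def Pure (x f : L) (w : List L) : Prop := ∀ l ∈ w, l = x ∨ l = f

theorem pure_cons {x f z : L} {w : List L} : Pure x f (z :: w) ↔ (z = x ∨ z = f) ∧ Pure x f w := by
  simp [Pure]

/-- The word `f x f x ⋯ f x` of length `2 k`. -/
def alt (x f : L) : ℕ → List L
  | 0 => []
  | k + 1 => f :: x :: alt x f k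

@[simp] theorem length_alt (x f : L) (k : ℕ) : (alt x f k).length = 2 * k := by
  induction k with
  | zero => rfl
  | succ k ih => simp [alt, ih]; ring

theorem head?_alt_ne {x f : L} (h : f ≠ x) (k : ℕ) : (alt x f k).head? ≠ some x := by
  cases k <;> simp [alt, h]

theorem good_alt {x f : L} (h : f ≠ x) (k : ℕ) : Good x f (alt x f k) := by
  induction k with
  | zero => trivial
  | succ k ih => exact (ih.cons_left h (head?_alt_ne h k)).cons_odd h rfl

theorem pure_alt (x f : L) (k : ℕ) : Pure x f (alt x f k) := by
  induction k with
  | zero => simp [Pure, alt]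
  | succ k ih => simp [alt, pure_cons, ih]

theorem cons_alt (x f : L) (k : ℕ) : x :: alt x f k = alt f x k ++ [x] := by
  induction k with
  | zero => rfl
  | succ k ih => simp [alt, ih]

theorem Good.eq_alt {x f : L} (h : f ≠ x) {w : List L} (hw : Good x f w) (hp : Pure x f w) :
    ∃ k, w = alt x f k ∨ w = x :: alt x f k := by
  induction w with
  | nil => exact ⟨0, Or.inl rfl⟩
  | cons z w ih =>
    rw [pure_cons] at hp
    obtain ⟨k, rfl | rfl⟩ := ih hw.1 hp.2
    · rcases hp.1 with rfl | rfl
      · exact ⟨k, Or.inr rfl⟩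
      · exact absurd (hw.2.2 rfl) (head?_alt_ne h k)
    · rcases hp.1 with rfl | rfl
      · exact absurd rfl (hw.2.1 rfl)
      · exact ⟨k + 1, Or.inl rfl⟩

variable [DecidableEq L]

instance (x f : L) (w : List L) : Decidable (Pure x f w) := by unfold Pure; infer_instance

theorem bd_shift_eq_zero {ε : L → ℂ} {x f z : L} (h : Signs ε x f) (hz : z ≠ x) {a : List L → ℂ}
    (ha : ∀ w, bd ε x f a (z :: w) = 0) : bd ε x f (fun u => a (z :: u)) = 0 := by
  funext w
  simpa [bd_cons, hz, h.ne_zero] using ha w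

/-- Each exchange of x f with f x costs a sign, by evaluating ∂a = 0 on a word x x x (f x)^k. -/
theorem apply_alt_swap {ε : L → ℂ} {x f : L} (h : Signs ε x f) {a : List L → ℂ}
    (ha : bd ε x f a = 0) (k : ℕ) : a (alt f x k) = (-1) ^ k * a (alt x f k) := by
  induction k generalizing a with
  | zero => simp [alt]
  | succ k ih =>
    have h1 : bd ε x f (fun u => a (x :: f :: u)) = 0 := by
      funext w
      simpa [bd_cons, h.ne, h.ne_zero] using congrFun ha (x :: f :: w)
    have h2 := congrFun ha (x :: x :: x :: alt x f k)
    rw [bd_cons, bd_cons, bd_apply_of_good ε _ ((good_alt h.ne k).cons_left h.ne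
      (head?_alt_ne h.ne k))] at h2
    simp only [h.even, if_true, lmul_cons, Pi.zero_apply] at h2
    have h3 := ih h1
    simp only [alt] at h3 ⊢
    rw [h3, pow_succ]
    linear_combination (-1) ^ k * h2

theorem apply_odd_cons_alt {ε : L → ℂ} {x f : L} (h : Signs ε x f) {a : List L → ℂ}
    (ha : bd ε x f a = 0) (k : ℕ) : a (f :: alt f x k) = 0 := by
  have h1 := apply_alt_swap h (bd_shift_eq_zero h h.ne fun w => congrFun ha (f :: w)) k
  have h2 := congrFun ha (x :: x :: alt x f k)
  rw [bd_cons, bd_apply_of_good ε _ ((good_alt h.ne k).cons_left h.ne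
      (head?_alt_ne h.ne k))] at h2
  simp only [if_true, lmul_cons, Pi.zero_apply, mul_zero, zero_add] at h2
  rw [h1, h2, mul_zero]

/-- The right multiplication by `x` on good words, modulo coboundaries. -/
def endMul (x f : L) : List L → (List L → ℂ) → ℂ
  | [], _ => 0
  | z :: w, g => if Pure x f (z :: w) then (if z = x then (-1) ^ (w.length / 2) * g w else 0)
      else endMul x f w (fun u => g (z :: u))

/-- Letters are stripped from the left until a pure word remains, where `apply_alt_swap` and
`apply_odd_cons_alt` apply. Stripping a letter other than x leaves a cycle. Stripping x leaves a
function whose coboundary lives on words starting with x; the second alternative in the hypothesis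
records this state. It lasts one step, since in a good word the next letter is not x. -/
theorem rmul_eq_endMul {ε : L → ℂ} {x f : L} (h : Signs ε x f) {w : List L} (hw : Good x f w)
    {a : List L → ℂ} (ha : bd ε x f a = 0 ∨ (¬ Pure x f w ∧ w.head? ≠ some x ∧
      ∀ v : List L, v.head? ≠ some x → bd ε x f a v = 0)) :
    rmul x a w = endMul x f w a := by
  induction w generalizing a with
  | nil => simp [endMul]
  | cons z w ih =>
    by_cases hp : Pure x f (z :: w)
    · have hc : bd ε x f a = 0 := by tauto
      rw [endMul, if_pos hp]
      obtain ⟨k, hk | hk⟩ := hw.eq_alt h.ne hp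
      · cases k with
        | zero => simp [alt] at hk
        | succ k =>
          have hz : z ≠ x := by
            rintro rfl
            simp [alt, h.ne.symm] at hk
          rw [hk, if_neg hz, alt, cons_alt, ← List.cons_append, rmul_append,
            apply_odd_cons_alt h hc]
      · obtain ⟨rfl, rfl⟩ := List.cons.inj hk
        rw [cons_alt, rmul_append, if_pos rfl, apply_alt_swap h hc]
        simp
    · rw [endMul, if_neg hp]
      cases w with
      | nil =>
        have hz : z ≠ x := by
          rintro rfl
          simp [Pure] at hp
        simp [rmul_singleton, hz, endMul]
      | cons y w =>
        rw [rmul_cons_cons]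
        apply ih hw.1
        by_cases hz : z = x
        · right
          subst hz
          have ha : bd ε z f a = 0 := by simpa using ha
          refine ⟨fun h' => hp (pure_cons.2 ⟨Or.inl rfl, h'⟩), hw.2.1 rfl, fun v hv => ?_⟩
          have := congrFun ha (z :: v)
          simpa [bd_cons, lmul_apply_of_head?_ne _ hv, h.even] using this
        · left
          apply bd_shift_eq_zero h hz
          intro v
          rcases ha with ha | ha
          · exact congrFun ha _
          · exact ha.2.2 _ (by simpa using hz)

theorem endMul_of_pure {x f : L} {w : List L} (hw : Pure x f w) (hx : w.head? ≠ some x)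
    (g : List L → ℂ) : endMul x f w g = 0 := by
  cases w with
  | nil => rfl
  | cons z w =>
    have hz : z ≠ x := by simpa using hx
    rw [endMul, if_pos hw, if_neg hz]

/-- The word v is w with the initial x of its longest pure suffix removed. This suffix has a letter
other than x and f before it, so the head is unchanged; the pure suffix of v no longer starts with
x, so a second application gives zero. -/
theorem endMul_of_not_pure {x f : L} (h : f ≠ x) {w : List L} (hw : Good x f w)
    (hp : ¬ Pure x f w) :
    (∀ g, endMul x f w g = 0) ∨ ∃ (c : ℂ) (v : List L), (∀ g, endMul x f w g = c * g v) ∧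
      Good x f v ∧ ¬ Pure x f v ∧ v.length + 1 = w.length ∧ v.head? = w.head? ∧
      ∀ g, endMul x f v g = 0 := by
  induction w with
  | nil => exact absurd (by simp [Pure]) hp
  | cons z w ih =>
    by_cases hp' : Pure x f w
    · have hz : ¬ (z = x ∨ z = f) := fun h' => hp (pure_cons.2 ⟨h', hp'⟩)
      by_cases hx : w.head? = some x
      · right
        cases w with
        | nil => simp at hx
        | cons y w =>
          have hy : y = x := by simpa using hx
          subst hy
          have hn : ¬ Pure y f (z :: w) := fun h' => hz (pure_cons.1 h').1
          refine ⟨(-1) ^ (w.length / 2), z :: w, fun g => ?_, ?_, hn, by simp, rfl, fun g => ?_⟩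
          · rw [endMul, if_neg hp, endMul, if_pos hp', if_pos rfl]
          · exact hw.1.1.cons_of_ne (fun h' => hz (Or.inl h')) (fun h' => hz (Or.inr h'))
          · rw [endMul, if_neg hn]
            exact endMul_of_pure (pure_cons.1 hp').2 (hw.1.2.1 rfl) _
      · left
        intro g
        rw [endMul, if_neg hp, endMul_of_pure hp' hx]
    · rcases ih hw.1 hp' with h0 | ⟨c, v, h1, h2, h3, h4, h5, h6⟩
      · left
        intro g
        rw [endMul, if_neg hp, h0]
      · right
        have hn : ¬ Pure x f (z :: v) := fun h' => h3 (pure_cons.1 h').2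
        refine ⟨c, z :: v, fun g => ?_, ⟨h2, ?_⟩, hn, by simp [← h4], rfl, fun g => ?_⟩
        · rw [endMul, if_neg hp, h1]
        · rw [h5]; exact hw.2
        · rw [endMul, if_neg hn, h6]

/-- The anticommutator with the letter `x`. -/
def anti (x : L) : (List L → ℂ) →ₗ[ℂ] (List L → ℂ) := lmul x + rmul x

theorem anti_apply (x : L) (a : List L → ℂ) (w : List L) :
    anti x a w = lmul x a w + rmul x a w := rfl

theorem anti_mem_hom (x : L) {n : ℕ} {a : List L → ℂ} (ha : a ∈ hom L n) :
    anti x a ∈ hom L (n + 1) := by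
  rw [mem_hom] at *
  intro w hw
  cases w with
  | nil => simp [anti_apply]
  | cons z w =>
    rw [anti_apply, rmul_apply, ha (z :: w).dropLast (by simpa using hw), lmul_cons,
      ha w (by simpa using hw)]
    simp

theorem bd_anti {ε : L → ℂ} {x f : L} (h : Signs ε x f) (a : List L → ℂ) :
    bd ε x f (anti x a) = anti x (bd ε x f a) := by
  simp [anti, bd_lmul_left h, bd_rmul h]

/-- The good words of length `n + 1` on which the anticommutator with `x` of a cycle of length `n`
may be prescribed, and which then determine its values on the other good words. -/
def Detecting (x f : L) (n : ℕ) (w : List L) : Prop :=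
  Good x f w ∧ w.head? = some x ∧ ¬ (n % 4 = 2 ∧ Pure x f w)

/-- On x (f x)^k the left and right multiplications give a ((f x)^k) and (-1)^k a ((f x)^k). This is
the source of the period 4 in the theorem. -/
theorem anti_cons_of_pure {ε : L → ℂ} {x f : L} (h : Signs ε x f) {a : List L → ℂ}
    (ha : bd ε x f a = 0) {w : List L} (hw : Good x f (x :: w)) (hp : Pure x f (x :: w)) :
    ∃ k, w.length = 2 * k ∧ anti x a (x :: w) = (1 + (-1) ^ k) * a w := by
  obtain ⟨k, hk | hk⟩ := hw.eq_alt h.ne hp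
  · have := head?_alt_ne h.ne k
    simp [← hk] at this
  · obtain ⟨-, rfl⟩ := List.cons.inj hk
    refine ⟨k, by simp, ?_⟩
    rw [anti_apply, rmul_eq_endMul h hw (Or.inl ha), endMul, if_pos hp]
    simp
    ring

/-- On a good word not starting with x, only right multiplication contributes, giving zero or a
multiple of some a (v). The latter is the value of the anticommutator on the detecting word x v,
since `endMul` vanishes on v. -/
theorem anti_eq_zero_of_detecting {ε : L → ℂ} {x f : L} (h : Signs ε x f) {n : ℕ}
    {a : List L → ℂ} (han : a ∈ hom L n) (ha : bd ε x f a = 0)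
    (H : ∀ w, Detecting x f n w → anti x a w = 0) {w : List L} (hw : Good x f w) :
    anti x a w = 0 := by
  by_cases hl : w.length = n + 1
  swap
  · exact mem_hom.1 (anti_mem_hom x han) w hl
  by_cases hx : w.head? = some x
  · by_cases hp : n % 4 = 2 ∧ Pure x f w
    · cases w with
      | nil => simp at hx
      | cons z w =>
        have hz : z = x := by simpa using hx
        subst hz
        obtain ⟨k, hk, h1⟩ := anti_cons_of_pure h ha hw hp.2
        have hl' : w.length = n := by simpa using hl
        have hodd : Odd k := by
          rw [Nat.odd_iff]; omega
        rw [h1, hodd.neg_one_pow]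
        ring
    · exact H w ⟨hw, hx, hp⟩
  · rw [anti_apply, lmul_apply_of_head?_ne _ hx, rmul_eq_endMul h hw (Or.inl ha), zero_add]
    by_cases hp : Pure x f w
    · exact endMul_of_pure hp hx a
    · rcases endMul_of_not_pure h.ne hw hp with h0 | ⟨c, v, h1, h2, h3, h4, h5, h6⟩
      · exact h0 a
      · rw [h1]
        have hv : Good x f (x :: v) := h2.cons_left h.ne (h5 ▸ hx)
        have hvp : ¬ Pure x f (x :: v) := fun h' => h3 (pure_cons.1 h').2
        have h7 := H (x :: v) ⟨hv, rfl, fun h' => hvp h'.2⟩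
        rw [anti_apply, rmul_eq_endMul h hv (Or.inl ha), endMul, if_neg hvp, h6] at h7
        simp only [lmul_cons, if_true, add_zero] at h7
        rw [h7, mul_zero]

theorem exists_cycle_anti_eq {ε : L → ℂ} {x f : L} (h : Signs ε x f) {n : ℕ} {g : List L → ℂ}
    (hg : g ∈ supp (Detecting x f n) (n + 1)) :
    ∃ a ∈ hom L n, bd ε x f a = 0 ∧ ∀ w, Detecting x f n w → anti x a w = g w := by
  obtain ⟨a, han, ha, hag⟩ := exists_cycle h n
    -- The 2 is 1 + (-1)^k for even k; for odd k the pure word is not detecting.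
    (fun w => if Pure x f w then g (x :: w) / 2 else g (x :: w))
  refine ⟨a, han, ha, fun w hw => ?_⟩
  by_cases hl : w.length = n + 1
  swap
  · rw [mem_hom.1 (anti_mem_hom x han) w hl, hg w (fun h' => hl h'.2)]
  obtain ⟨hw, hx, hq⟩ := hw
  cases w with
  | nil => simp at hx
  | cons z w =>
    have hz : z = x := by simpa using hx
    subst hz
    have hl' : w.length = n := by simpa using hl
    have haw := hag w hw.1 hl'
    by_cases hp : Pure z f (z :: w)
    · obtain ⟨k, hk, h1⟩ := anti_cons_of_pure h ha hw hp
      have heven : Even k := by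
        rw [Nat.even_iff]; by_contra hk'; exact hq ⟨by omega, hp⟩
      rw [h1, heven.neg_one_pow, haw, if_pos (pure_cons.1 hp).2]
      ring
    · rw [anti_apply, rmul_eq_endMul h hw (Or.inl ha), lmul_cons, if_pos rfl, haw,
        if_neg fun h' => hp (pure_cons.2 ⟨Or.inl rfl, h'⟩)]
      rcases endMul_of_not_pure h.ne hw hp with h0 | ⟨c, v, h1, h2, h3, h4, h5, h6⟩
      · rw [h0, add_zero]
      -- Here v starts with x, so x v is not good, g vanishes on it, and right multiplication
      -- contributes nothing.
      · have hv : ¬ Good z f (z :: v) := fun h' => h'.2.1 rfl h5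
        rw [h1, hag v h2 (by simpa [hl'] using h4), if_neg h3, hg _ fun h' => hv h'.1.1]
        simp

end Pure

end WordComplex

/-! ### Rank-nullity and counting of words -/

noncomputable section
namespace WordComplex
open Module

theorem finrank_map_add_finrank_inf_ker {V V' : Type*} [AddCommGroup V] [Module ℂ V]
    [AddCommGroup V'] [Module ℂ V'] (S : Submodule ℂ V) [FiniteDimensional ℂ S] (φ : V →ₗ[ℂ] V') :
    finrank ℂ (S.map φ) + finrank ℂ (S ⊓ LinearMap.ker φ : Submodule ℂ V) = finrank ℂ S := by
  have h1 := (φ.domRestrict S).finrank_range_add_finrank_ker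
  rw [LinearMap.range_domRestrict] at h1
  have e : LinearMap.ker (φ.domRestrict S) ≃ₗ[ℂ] (S ⊓ LinearMap.ker φ : Submodule ℂ V) :=
    { toFun := fun v => ⟨v.1.1, v.1.2, v.2⟩
      invFun := fun v => ⟨⟨v.1, v.2.1⟩, v.2.2⟩
      map_add' := fun _ _ => rfl
      map_smul' := fun _ _ => rfl
      left_inv := fun _ => rfl
      right_inv := fun _ => rfl }
  rw [← h1, e.finrank_eq]

/-- A product of subspaces is isomorphic to the product of the corresponding types. -/
def piSubmoduleEquiv {ι : Type*} {V : Type*} [AddCommGroup V] [Module ℂ V]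
    (S : ι → Submodule ℂ V) : Submodule.pi Set.univ S ≃ₗ[ℂ] (∀ i, S i) where
  toFun v i := ⟨v.1 i, v.2 i trivial⟩
  invFun v := ⟨fun i => v i, fun i _ => (v i).2⟩
  map_add' _ _ := rfl
  map_smul' _ _ := rfl
  left_inv _ := rfl
  right_inv _ := rfl

section Count

variable {L : Type*}

/-- A function on words of length `n + 1` is a family of functions on words of length `n`. -/
def suppSuccEquiv (Q : List L → Prop) (n : ℕ) :
    supp Q (n + 1) ≃ₗ[ℂ] (∀ z, supp (fun w => Q (z :: w)) n) where
  toFun a z := ⟨fun w => a.1 (z :: w), fun w hw => a.2 _ (by simpa using hw)⟩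
  invFun A := ⟨glue fun z => (A z).1, by
    rintro (_ | ⟨z, w⟩) hw
    · rfl
    · exact (A z).2 w (by simpa using hw)⟩
  map_add' _ _ := rfl
  map_smul' _ _ := rfl
  left_inv a := by
    ext w
    cases w with
    | nil => exact (a.2 [] (by simp)).symm
    | cons z w => rfl
  right_inv _ := rfl

variable [Fintype L]

open Classical in
/-- The number of words of length `n` with the property `Q`. -/
def cnt : ℕ → (List L → Prop) → ℕ
  | 0, Q => if Q [] then 1 else 0
  | n + 1, Q => ∑ z, cnt n fun w => Q (z :: w)

theorem finrank_supp_aux (n : ℕ) (Q : List L → Prop) :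
    FiniteDimensional ℂ (supp Q n) ∧ finrank ℂ (supp Q n) = cnt n Q := by
  induction n generalizing Q with
  | zero =>
    by_cases hQ : Q []
    · have e : supp Q 0 ≃ₗ[ℂ] ℂ :=
        { toFun := fun a => a.1 []
          invFun := fun c => ⟨fun w => match w with | [] => c | _ :: _ => 0, by
            rintro (_ | ⟨z, w⟩) hw
            · exact absurd ⟨hQ, rfl⟩ hw
            · rfl⟩
          map_add' := fun _ _ => rfl
          map_smul' := fun _ _ => rfl
          left_inv := fun a => by
            ext w
            cases w with
            | nil => rfl
            | cons z w => exact (a.2 _ (by simp)).symm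
          right_inv := fun _ => rfl }
      exact ⟨Module.Finite.equiv e.symm, by rw [e.finrank_eq]; simp [cnt, hQ]⟩
    · have e : supp Q 0 = ⊥ := by
        rw [eq_bot_iff]
        intro a ha
        rw [Submodule.mem_bot]
        funext w
        exact ha w (by rintro ⟨h1, h2⟩; rw [List.length_eq_zero_iff.1 h2] at h1; exact hQ h1)
      rw [e]
      exact ⟨inferInstance, by simp [cnt, hQ]⟩
  | succ n ih =>
    have := fun z => (ih fun w => Q (z :: w)).1
    refine ⟨Module.Finite.equiv (suppSuccEquiv Q n).symm, ?_⟩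
    rw [(suppSuccEquiv Q n).finrank_eq, finrank_pi_fintype, cnt]
    exact Finset.sum_congr rfl fun z _ => (ih _).2

instance (n : ℕ) (Q : List L → Prop) : FiniteDimensional ℂ (supp Q n) := (finrank_supp_aux n Q).1

theorem finrank_supp (n : ℕ) (Q : List L → Prop) : finrank ℂ (supp Q n) = cnt n Q :=
  (finrank_supp_aux n Q).2

theorem cnt_congr {n : ℕ} {Q Q' : List L → Prop} (h : ∀ w, w.length = n → (Q w ↔ Q' w)) :
    cnt n Q = cnt n Q' := by
  induction n generalizing Q Q' with
  | zero =>
    have := h [] rfl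
    by_cases hQ : Q [] <;> simp [cnt, hQ, ← this]
  | succ n ih => exact Finset.sum_congr rfl fun z _ => ih fun w hw => h _ (by simp [hw])

theorem cnt_and_add_cnt_and_not (n : ℕ) (Q Q' : List L → Prop) :
    cnt n (fun w => Q w ∧ Q' w) + cnt n (fun w => Q w ∧ ¬ Q' w) = cnt n Q := by
  induction n generalizing Q Q' with
  | zero => simp only [cnt]; by_cases h : Q [] <;> by_cases h' : Q' [] <;> simp [h, h']
  | succ n ih =>
    simp only [cnt, ← Finset.sum_add_distrib]
    exact Finset.sum_congr rfl fun z _ => ih _ _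

theorem cnt_true (n : ℕ) : cnt n (fun _ : List L => True) = Fintype.card L ^ n := by
  induction n with
  | zero => simp [cnt]
  | succ n ih => simp [cnt, ih, pow_succ']

theorem cnt_false (n : ℕ) : cnt n (fun _ : List L => False) = 0 := by
  induction n with
  | zero => simp [cnt]
  | succ n ih => simp [cnt, ih]

theorem cnt_eq (w : List L) : cnt w.length (fun v => v = w) = 1 := by
  induction w with
  | nil => simp [cnt]
  | cons z w ih =>
    rw [List.length_cons, cnt, Finset.sum_eq_single z]
    · simpa using ih
    · intro y _ hy
      simpa [hy] using cnt_false w.length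
    · simp

theorem cnt_good_head (x f : L) (h : f ≠ x) (n : ℕ) :
    cnt (n + 1) (fun w => Good x f w ∧ w.head? = some x) +
      cnt n (fun w => Good x f w ∧ w.head? = some x) = cnt n (Good x f) := by
  rw [← cnt_and_add_cnt_and_not n (Good x f) fun w => w.head? = some x, add_comm, cnt,
    Finset.sum_eq_single x]
  · congr 1
    apply cnt_congr
    intro w _
    simp only [List.head?_cons, and_true]
    exact ⟨fun hw => ⟨hw.1, hw.2.1 rfl⟩, fun hw => hw.1.cons_left h hw.2⟩
  · intro y _ hy
    rw [← cnt_false (L := L) n]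
    exact cnt_congr fun w _ => by simp [hy]
  · simp

/-- Prepending x fails exactly on good words starting with x, and prepending f exactly on the
others. Together these failures amount to one copy of the good words of length n. -/
theorem cnt_good_succ (x f : L) (h : f ≠ x) (n : ℕ) :
    cnt (n + 1) (Good x f) + cnt n (Good x f) = Fintype.card L * cnt n (Good x f) := by
  classical
  have key : ∀ z, cnt n (fun w => Good x f (z :: w)) +
      ((if z = x then cnt n (fun w => Good x f w ∧ w.head? = some x) else 0) +
      (if z = f then cnt n (fun w => Good x f w ∧ ¬ w.head? = some x) else 0)) =
        cnt n (Good x f) := by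
    intro z
    by_cases hx : z = x
    · subst hx
      rw [if_pos rfl, if_neg h.symm, add_zero, add_comm,
        ← cnt_and_add_cnt_and_not n (Good z f) fun w => w.head? = some z]
      congr 1
      exact cnt_congr fun w _ => ⟨fun hw => ⟨hw.1, hw.2.1 rfl⟩, fun hw => hw.1.cons_left h hw.2⟩
    · by_cases hf : z = f
      · subst hf
        rw [if_neg hx, if_pos rfl, zero_add,
          ← cnt_and_add_cnt_and_not n (Good x z) fun w => w.head? = some x]
        congr 1
        exact cnt_congr fun w _ => ⟨fun hw => ⟨hw.1, hw.2.2 rfl⟩, fun hw => hw.1.cons_odd h hw.2⟩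
      · rw [if_neg hx, if_neg hf, add_zero, add_zero]
        exact cnt_congr fun w _ => ⟨fun hw => hw.1, fun hw => hw.cons_of_ne hx hf⟩
  have hsum := Finset.sum_congr (rfl : (Finset.univ : Finset L) = Finset.univ)
    fun z _ => key z
  rw [Finset.sum_add_distrib, Finset.sum_add_distrib, Finset.sum_ite_eq' Finset.univ x,
    Finset.sum_ite_eq' Finset.univ f, if_pos (Finset.mem_univ _), if_pos (Finset.mem_univ _),
    cnt_and_add_cnt_and_not n (Good x f) fun w => w.head? = some x, Finset.sum_const,
    Finset.card_univ, smul_eq_mul] at hsum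
  exact hsum

theorem cnt_good (x f : L) (h : f ≠ x) (n : ℕ) :
    cnt n (Good x f) = (Fintype.card L - 1) ^ n := by
  induction n with
  | zero => simp [cnt, Good]
  | succ n ih =>
    have := cnt_good_succ x f h n
    rw [pow_succ', ← ih, Nat.sub_mul]
    omega

/-- For n ≡ 2 modulo 4 exactly one word is excluded, namely x (f x)^(n/2). -/
theorem cnt_detecting [DecidableEq L] (x f : L) (h : f ≠ x) (n : ℕ) :
    cnt (n + 1) (Detecting x f n) + (if n % 4 = 2 then 1 else 0) =
      cnt (n + 1) (fun w => Good x f w ∧ w.head? = some x) := by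
  split_ifs with hn
  · rw [← cnt_and_add_cnt_and_not (n + 1) (fun w => Good x f w ∧ w.head? = some x) (Pure x f),
      add_comm]
    have hl : (x :: alt x f (n / 2)).length = n + 1 := by simp; omega
    congr 1
    · have h1 := cnt_eq (x :: alt x f (n / 2))
      rw [hl] at h1
      refine h1.symm.trans ?_
      apply cnt_congr
      intro w hw
      constructor
      · rintro rfl
        exact ⟨⟨(good_alt h _).cons_left h (head?_alt_ne h _), rfl⟩,
          pure_cons.2 ⟨Or.inl rfl, pure_alt _ _ _⟩⟩
      · rintro ⟨⟨hg, hx⟩, hp⟩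
        obtain ⟨k, rfl | rfl⟩ := hg.eq_alt h hp
        · exact absurd hx (head?_alt_ne h k)
        · have : k = n / 2 := by simp at hw; omega
          rw [this]
    · apply cnt_congr
      intro w _
      simp [Detecting, hn, and_assoc]
  · rw [add_zero]
    apply cnt_congr
    intro w _
    simp [Detecting, hn]

end Count

/-! ### Dimensions of the cycles and the rank of the anticommutator -/

section Rank

variable {L : Type*}

open Classical in
/-- Restriction to the words with the property `Q`. -/
def restr (Q : List L → Prop) : (List L → ℂ) →ₗ[ℂ] (List L → ℂ) where
  toFun a w := if Q w then a w else 0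
  map_add' a b := by funext w; simp only [Pi.add_apply]; split_ifs <;> simp
  map_smul' c a := by funext w; simp

theorem restr_eq_zero {Q : List L → Prop} {a : List L → ℂ} :
    restr Q a = 0 ↔ ∀ w, Q w → a w = 0 := by
  constructor
  · intro h w hw
    simpa [restr, hw] using congrFun h w
  · intro h
    funext w
    by_cases hw : Q w <;> simp [restr, hw, h]

theorem restr_mem_supp {Q : List L → Prop} {n : ℕ} {a : List L → ℂ} (ha : a ∈ hom L n) :
    restr Q a ∈ supp Q n := by
  intro w hw
  by_cases h : Q w
  · have : w.length ≠ n := fun h' => hw ⟨h, h'⟩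
    simp [restr, mem_hom.1 ha w this]
  · simp [restr, h]

variable [DecidableEq L]

theorem bd_mem_hom (ε : L → ℂ) (x f : L) {n : ℕ} {a : List L → ℂ} (ha : a ∈ hom L n) :
    bd ε x f a ∈ hom L (n + 1) := by
  rw [mem_hom] at *
  intro w hw
  induction w generalizing a n with
  | nil => rfl
  | cons z w ih =>
    have h1 : lmul x (fun u => a (f :: u)) w = 0 := by
      cases w with
      | nil => rfl
      | cons y w => simp [ha (f :: w) (by simpa using hw)]
    rw [bd_cons, h1]
    cases n with
    | zero =>
      have h2 : (fun u => a (z :: u)) = 0 := by funext u; exact ha _ (by simp)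
      rw [h2]
      simp
    | succ n =>
      rw [ih (n := n) (fun w hw => ha _ (by simpa using hw)) (by simpa using hw)]
      simp

/-- The cycles of length `n`. -/
abbrev cyc (ε : L → ℂ) (x f : L) (n : ℕ) : Submodule ℂ (List L → ℂ) :=
  hom L n ⊓ LinearMap.ker (bd ε x f)

theorem map_restr_cyc {ε : L → ℂ} {x f : L} (h : Signs ε x f) (n : ℕ) :
    (cyc ε x f n).map (restr (Good x f)) = supp (Good x f) n := by
  apply le_antisymm
  · rintro _ ⟨a, ha, rfl⟩
    exact restr_mem_supp ha.1
  · intro g hg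
    obtain ⟨a, ha, hb, hag⟩ := exists_cycle h n g
    refine ⟨a, ⟨ha, hb⟩, ?_⟩
    funext w
    by_cases hw : Good x f w ∧ w.length = n
    · simp [restr, hw.1, hag w hw.1 hw.2]
    · rw [hg w hw]
      exact restr_mem_supp ha w hw

theorem cyc_inf_ker_restr {ε : L → ℂ} {x f : L} (h : Signs ε x f) (n : ℕ) :
    cyc ε x f (n + 1) ⊓ LinearMap.ker (restr (Good x f)) = (hom L n).map (bd ε x f) := by
  apply le_antisymm
  · rintro a ⟨ha, hr⟩
    obtain ⟨b, hb, rfl⟩ := exists_bd_eq h (n + 1) ha.1 ha.2 (restr_eq_zero.1 hr)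
    exact ⟨b, mem_hom.2 fun w hw => hb w (by simpa using hw), rfl⟩
  · rintro _ ⟨b, hb, rfl⟩
    exact ⟨⟨bd_mem_hom ε x f hb, bd_bd h b⟩,
      restr_eq_zero.2 fun w hw => bd_apply_of_good ε b hw⟩

variable [Fintype L]

instance (S T : Submodule ℂ (List L → ℂ)) [FiniteDimensional ℂ S] :
    FiniteDimensional ℂ (S ⊓ T : Submodule ℂ (List L → ℂ)) :=
  Submodule.finiteDimensional_inf_left S T

theorem finrank_bd_add_finrank_cyc (ε : L → ℂ) (x f : L) (n : ℕ) :
    finrank ℂ ((hom L n).map (bd ε x f)) + finrank ℂ (cyc ε x f n) = Fintype.card L ^ n := by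
  rw [finrank_map_add_finrank_inf_ker, finrank_supp, cnt_true]

theorem finrank_cyc_zero {ε : L → ℂ} {x f : L} (h : Signs ε x f) :
    finrank ℂ (cyc ε x f 0) = cnt 0 (Good x f) := by
  have h1 := finrank_map_add_finrank_inf_ker (cyc ε x f 0) (restr (Good x f))
  have h2 : cyc ε x f 0 ⊓ LinearMap.ker (restr (Good x f)) = ⊥ := by
    rw [eq_bot_iff]
    rintro a ⟨ha, hr⟩
    obtain ⟨b, hb, rfl⟩ := exists_bd_eq h 0 ha.1 ha.2 (restr_eq_zero.1 hr)
    have : b = 0 := by funext w; exact hb w (by simp)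
    simp [this]
  rw [h2, finrank_bot, map_restr_cyc h, finrank_supp] at h1
  exact h1.symm

theorem finrank_cyc_succ {ε : L → ℂ} {x f : L} (h : Signs ε x f) (n : ℕ) :
    finrank ℂ (cyc ε x f (n + 1)) + finrank ℂ (cyc ε x f n) =
      cnt (n + 1) (Good x f) + Fintype.card L ^ n := by
  have h1 := finrank_map_add_finrank_inf_ker (cyc ε x f (n + 1)) (restr (Good x f))
  rw [cyc_inf_ker_restr h, map_restr_cyc h, finrank_supp] at h1
  have h2 := finrank_bd_add_finrank_cyc ε x f n
  omega

/-- The cycles whose anticommutator with `x` is a coboundary. -/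
abbrev antiCyc (ε : L → ℂ) (x f : L) (n : ℕ) : Submodule ℂ (List L → ℂ) :=
  cyc ε x f n ⊓ LinearMap.ker (restr (Good x f) ∘ₗ anti x)

/-- Rank-nullity for the anticommutator restricted to detecting words: it is onto by
`exists_cycle_anti_eq`, and its kernel on cycles is `antiCyc` by `anti_eq_zero_of_detecting`. -/
theorem finrank_antiCyc {ε : L → ℂ} {x f : L} (h : Signs ε x f) (n : ℕ) :
    finrank ℂ (antiCyc ε x f n) + cnt (n + 1) (Detecting x f n) = finrank ℂ (cyc ε x f n) := by
  have h1 := finrank_map_add_finrank_inf_ker (cyc ε x f n) (restr (Detecting x f n) ∘ₗ anti x)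
  have h2 : cyc ε x f n ⊓ LinearMap.ker (restr (Detecting x f n) ∘ₗ anti x) =
      antiCyc ε x f n := by
    ext a
    constructor
    · rintro ⟨ha, hr⟩
      exact ⟨ha, restr_eq_zero.2 fun w hw =>
        anti_eq_zero_of_detecting h ha.1 ha.2 (restr_eq_zero.1 hr) hw⟩
    · rintro ⟨ha, hr⟩
      exact ⟨ha, restr_eq_zero.2 fun w hw => restr_eq_zero.1 hr w hw.1⟩
  have h3 : (cyc ε x f n).map (restr (Detecting x f n) ∘ₗ anti x) =
      supp (Detecting x f n) (n + 1) := by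
    apply le_antisymm
    · rintro _ ⟨a, ha, rfl⟩
      exact restr_mem_supp (anti_mem_hom x ha.1)
    · intro g hg
      obtain ⟨a, ha, hb, hag⟩ := exists_cycle_anti_eq h hg
      refine ⟨a, ⟨ha, hb⟩, ?_⟩
      funext w
      by_cases hw : Detecting x f n w
      · simp [restr, hw, hag w hw]
      · simp [restr, hw, hg w fun h' => hw h'.1]
  rw [h2, h3, finrank_supp] at h1
  omega

end Rank

/-! ### The coboundary operator on families of coefficient functions -/

section Differential

variable {L : Type*}

/-- Multiplication of the value on a word by the sign of the word. -/
def twist (ε : L → ℂ) : (List L → ℂ) →ₗ[ℂ] (List L → ℂ) where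
  toFun a w := (w.map ε).prod * a w
  map_add' a b := by funext w; simp [mul_add]
  map_smul' c a := by funext w; simp; ring

theorem twist_apply (ε : L → ℂ) (a : List L → ℂ) (w : List L) :
    twist ε a w = (w.map ε).prod * a w := rfl

theorem twist_mem_hom (ε : L → ℂ) {n : ℕ} {a : List L → ℂ} (ha : a ∈ hom L n) :
    twist ε a ∈ hom L n :=
  mem_hom.2 fun w hw => by rw [twist_apply, mem_hom.1 ha w hw, mul_zero]

theorem Signs.twist_twist {ε : L → ℂ} {x f : L} (h : Signs ε x f) (a : List L → ℂ) :
    twist ε (twist ε a) = a := by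
  funext w
  have : ∀ w : List L, (w.map ε).prod * (w.map ε).prod = 1 := by
    intro w
    induction w with
    | nil => simp
    | cons z w ih =>
      rw [List.map_cons, List.prod_cons]
      linear_combination (w.map ε).prod * (w.map ε).prod * h.sq z + ih
  rw [twist_apply, twist_apply, ← mul_assoc, this, one_mul]

/-- The families of coefficient functions of `n`-cochains. -/
abbrev homs (L : Type*) (n : ℕ) : Submodule ℂ (L → List L → ℂ) :=
  Submodule.pi Set.univ fun _ => hom L n

theorem mem_homs {n : ℕ} {a : L → List L → ℂ} : a ∈ homs L n ↔ ∀ i, a i ∈ hom L n := by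
  simp [homs, Submodule.mem_pi]

theorem finrank_pi_submodule [Fintype L] {V : Type*} [AddCommGroup V] [Module ℂ V]
    (S : L → Submodule ℂ V) [∀ i, FiniteDimensional ℂ (S i)] :
    finrank ℂ (Submodule.pi Set.univ S) = ∑ i, finrank ℂ (S i) := by
  rw [(piSubmoduleEquiv S).finrank_eq, finrank_pi_fintype]

instance [Fintype L] {V : Type*} [AddCommGroup V] [Module ℂ V] (S : L → Submodule ℂ V)
    [∀ i, FiniteDimensional ℂ (S i)] : FiniteDimensional ℂ (Submodule.pi Set.univ S) :=
  Module.Finite.equiv (piSubmoduleEquiv S).symm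

theorem finrank_homs [Fintype L] (n : ℕ) : finrank ℂ (homs L n) = Fintype.card L * Fintype.card L ^ n := by
  rw [finrank_pi_submodule, finrank_supp, cnt_true]
  simp

variable [DecidableEq L]

theorem twist_anti {ε : L → ℂ} {x f : L} (h : Signs ε x f) (a : List L → ℂ) :
    twist ε (anti x a) = anti x (twist ε a) := by
  funext w
  have h1 : twist ε (lmul x a) w = lmul x (twist ε a) w := by
    cases w with
    | nil => simp [twist_apply]
    | cons z w =>
      by_cases hz : z = x
      · subst hz; simp [twist_apply, h.even]
      · simp [twist_apply, hz]
  have h2 : twist ε (rmul x a) w = rmul x (twist ε a) w := by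
    rcases List.eq_nil_or_concat w with rfl | ⟨v, z, rfl⟩
    · simp [twist_apply]
    · by_cases hz : z = x
      · subst hz; simp [twist_apply, rmul_apply, h.even]
      · simp [twist_apply, rmul_apply, hz]
  rw [anti_apply, ← h1, ← h2, anti, LinearMap.add_apply, map_add]
  rfl

/-- Replacing the odd letter f by the even word x x changes the sign of a word. -/
theorem bd_twist {ε : L → ℂ} {x f : L} (h : Signs ε x f) (a : List L → ℂ) :
    bd ε x f (twist ε a) = - twist ε (bd ε x f a) := by
  funext w
  induction w generalizing a with
  | nil => simp [twist_apply]
  | cons z w ih =>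
    have h1 : ∀ z, (fun u => twist ε a (z :: u)) = ε z • twist ε (fun u => a (z :: u)) := by
      intro z
      funext u
      simp [twist_apply, mul_assoc]
    have h2 : twist ε (lmul x fun u => a (f :: u)) w =
        lmul x (twist ε fun u => a (f :: u)) w := by
      cases w with
      | nil => simp [twist_apply]
      | cons y w =>
        by_cases hy : y = x
        · subst hy; simp [twist_apply, h.even]
        · simp [twist_apply, hy]
    rw [bd_cons, h1, h1, map_smul, map_smul]
    simp only [Pi.smul_apply, smul_eq_mul, ih, Pi.neg_apply, twist_apply] at h2 ⊢
    rw [← h2, bd_cons, List.map_cons, List.prod_cons, h.odd]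
    split_ifs with hz
    · subst hz
      rw [h.even]
      ring
    · ring

/-- The coboundary operator on families of coefficient functions. -/
def dif (ε : L → ℂ) (x f : L) : (L → List L → ℂ) →ₗ[ℂ] (L → List L → ℂ) where
  toFun a i := ε i • twist ε (bd ε x f (a i)) + if i = f then anti x (a x) else 0
  map_add' a b := by
    funext i
    simp only [Pi.add_apply, map_add, smul_add]
    split_ifs
    · abel
    · simp
  map_smul' c a := by
    funext i
    simp only [Pi.smul_apply, map_smul, RingHom.id_apply, smul_add, smul_comm c]
    split_ifs <;> simp

theorem dif_apply (ε : L → ℂ) (x f : L) (a : L → List L → ℂ) (i : L) :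
    dif ε x f a i = ε i • twist ε (bd ε x f (a i)) + if i = f then anti x (a x) else 0 := rfl

theorem dif_dif {ε : L → ℂ} {x f : L} (h : Signs ε x f) (a : L → List L → ℂ) :
    dif ε x f (dif ε x f a) = 0 := by
  funext i
  rw [dif_apply, dif_apply, dif_apply, if_neg h.ne.symm, add_zero, map_add, map_smul,
    bd_twist h, bd_bd h]
  split_ifs with hi
  · subst hi
    rw [bd_anti h, h.odd, h.even, one_smul, map_zero, neg_zero, smul_zero, zero_add,
      twist_anti h, neg_one_smul, neg_add_cancel]
    rfl
  · simp

theorem dif_mem_homs (ε : L → ℂ) (x f : L) {n : ℕ} {a : L → List L → ℂ} (ha : a ∈ homs L n) :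
    dif ε x f a ∈ homs L (n + 1) := by
  rw [mem_homs] at *
  intro i
  rw [dif_apply]
  refine add_mem (Submodule.smul_mem _ _ (twist_mem_hom ε (bd_mem_hom ε x f (ha i)))) ?_
  split_ifs
  · exact anti_mem_hom x (ha x)
  · exact zero_mem _

/-- The cocycles of `dif` of length `n`. -/
abbrev cocyc (ε : L → ℂ) (x f : L) (n : ℕ) : Submodule ℂ (L → List L → ℂ) :=
  homs L n ⊓ LinearMap.ker (dif ε x f)

theorem mem_cocyc {ε : L → ℂ} {x f : L} (h : Signs ε x f) {n : ℕ} {a : L → List L → ℂ} :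
    a ∈ cocyc ε x f n ↔ (∀ i, a i ∈ hom L n) ∧ (∀ i, i ≠ f → bd ε x f (a i) = 0) ∧
      bd ε x f (a f) = twist ε (anti x (a x)) := by
  rw [Submodule.mem_inf, mem_homs, LinearMap.mem_ker, funext_iff]
  refine and_congr_right fun _ => ?_
  simp only [dif_apply, Pi.zero_apply]
  constructor
  · intro H
    refine ⟨fun i hi => ?_, ?_⟩
    · have h1 := H i
      rw [if_neg hi, add_zero] at h1
      have h2 := (smul_eq_zero.1 h1).resolve_left (h.ne_zero i)
      rw [← h.twist_twist (bd ε x f (a i)), h2, map_zero]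
    · have h1 := H f
      rw [if_pos rfl, h.odd, neg_one_smul, neg_add_eq_zero] at h1
      rw [← h1, h.twist_twist]
  · rintro ⟨H1, H2⟩ i
    by_cases hi : i = f
    · subst hi
      rw [H2, h.twist_twist, h.odd]
      simp
    · rw [H1 i hi]
      simp [hi]

variable [Fintype L]

/-- Forget the coefficient of f. The kernel consists of the cycles placed at f; in the image every
other coefficient is an arbitrary cycle, except that the one at x must lie in `antiCyc`. -/
theorem finrank_cocyc {ε : L → ℂ} {x f : L} (h : Signs ε x f) (n : ℕ) :
    finrank ℂ (cocyc ε x f n) + cnt (n + 1) (Detecting x f n) =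
      Fintype.card L * finrank ℂ (cyc ε x f n) := by
  let forget : (L → List L → ℂ) →ₗ[ℂ] (L → List L → ℂ) :=
    LinearMap.pi fun i => if i = f then 0 else LinearMap.proj i
  have hforget : ∀ a i, forget a i = if i = f then 0 else a i := by
    intro a i
    simp only [forget, LinearMap.pi_apply]
    split_ifs <;> rfl
  let S : L → Submodule ℂ (List L → ℂ) := fun i =>
    if i = f then ⊥ else if i = x then antiCyc ε x f n else cyc ε x f n
  let T : L → Submodule ℂ (List L → ℂ) := fun i => if i = f then cyc ε x f n else ⊥
  have hSf : S f = ⊥ := if_pos rfl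
  have hSx : S x = antiCyc ε x f n := by simp [S, h.ne.symm]
  have hSi : ∀ i, i ≠ f → i ≠ x → S i = cyc ε x f n := fun i h1 h2 => by simp [S, h1, h2]
  have hTf : T f = cyc ε x f n := if_pos rfl
  have hTi : ∀ i, i ≠ f → T i = ⊥ := fun i h1 => if_neg h1
  have hS : ∀ i, FiniteDimensional ℂ (S i) := by
    intro i
    by_cases hf : i = f
    · rw [hf, hSf]; infer_instance
    by_cases hx : i = x
    · rw [hx, hSx]; infer_instance
    · rw [hSi i hf hx]; infer_instance
  have hT : ∀ i, FiniteDimensional ℂ (T i) := by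
    intro i
    by_cases hf : i = f
    · rw [hf, hTf]; infer_instance
    · rw [hTi i hf]; infer_instance
  have h1 := finrank_map_add_finrank_inf_ker (cocyc ε x f n) forget
  have hker : cocyc ε x f n ⊓ LinearMap.ker forget = Submodule.pi Set.univ T := by
    ext a
    rw [Submodule.mem_inf, mem_cocyc h, LinearMap.mem_ker, Submodule.mem_pi]
    constructor
    · rintro ⟨⟨H1, -, H3⟩, H4⟩ i -
      have H0 : ∀ i, i ≠ f → a i = 0 := fun i hi => by
        have := hforget a i
        rw [H4, if_neg hi] at this
        exact this.symm
      by_cases hi : i = f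
      · rw [hi, hTf]
        refine ⟨H1 f, ?_⟩
        change bd ε x f (a f) = 0
        rw [H3, H0 x h.ne.symm, map_zero, map_zero]
      · rw [H0 i hi]
        exact zero_mem _
    · intro H
      have H0 : ∀ i, i ≠ f → a i = 0 := fun i hi => by
        have := H i trivial
        rwa [hTi i hi] at this
      have Hf : a f ∈ cyc ε x f n := hTf ▸ H f trivial
      refine ⟨⟨fun i => ?_, fun i hi => by rw [H0 i hi, map_zero], ?_⟩, ?_⟩
      · by_cases hi : i = f
        · rw [hi]; exact Hf.1
        · rw [H0 i hi]; exact zero_mem _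
      · rw [H0 x h.ne.symm, map_zero, map_zero]; exact Hf.2
      · funext i
        rw [hforget]
        split_ifs with hi
        · rfl
        · exact H0 i hi
  have hrange : (cocyc ε x f n).map forget = Submodule.pi Set.univ S := by
    apply le_antisymm
    · rintro _ ⟨a, ha, rfl⟩
      obtain ⟨H1, H2, H3⟩ := (mem_cocyc h).1 ha
      rw [Submodule.mem_pi]
      intro i _
      rw [hforget]
      split_ifs with hf
      · exact zero_mem _
      by_cases hx : i = x
      · rw [hx, hSx]
        refine ⟨⟨H1 x, H2 x h.ne.symm⟩, restr_eq_zero.2 fun w hw => ?_⟩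
        rw [← h.twist_twist (anti x (a x)), ← H3, twist_apply, bd_apply_of_good ε _ hw, mul_zero]
      · rw [hSi i hf hx]
        exact ⟨H1 i, H2 i hf⟩
    · intro a ha
      rw [Submodule.mem_pi] at ha
      have Hf : a f = 0 := by
        have := ha f trivial
        rwa [hSf] at this
      have Hx : a x ∈ antiCyc ε x f n := hSx ▸ ha x trivial
      have Hi : ∀ i, i ≠ f → a i ∈ cyc ε x f n := by
        intro i hi
        by_cases hx : i = x
        · rw [hx]; exact Hx.1
        · exact hSi i hi hx ▸ ha i trivial
      -- The forgotten coefficient is recovered as a primitive of the twisted anticommutator, a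
      -- cycle that vanishes on good words.
      obtain ⟨b, hb, hbd⟩ := exists_bd_eq h (n + 1) (a := twist ε (anti x (a x)))
        (twist_mem_hom ε (anti_mem_hom x Hx.1.1))
        (by rw [bd_twist h, bd_anti h, Hx.1.2, map_zero, map_zero, neg_zero])
        (fun w hw => by rw [twist_apply, restr_eq_zero.1 Hx.2 w hw, mul_zero])
      refine ⟨fun i => if i = f then b else a i, (mem_cocyc h).2 ⟨fun i => ?_, fun i hi => ?_, ?_⟩,
        ?_⟩
      · by_cases hi : i = f
        · simp only [hi, if_true]
          exact mem_hom.2 fun w hw => hb w (by simpa using hw)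
        · simp only [hi, if_false]
          exact (Hi i hi).1
      · simp only [hi, if_false]
        exact (Hi i hi).2
      · simp only [if_true, h.ne.symm, if_false]
        exact hbd
      · funext i
        rw [hforget]
        split_ifs with hi
        · rw [hi, Hf]
        · rfl
  rw [hker, hrange, finrank_pi_submodule, finrank_pi_submodule] at h1
  have h2 : ∀ i, finrank ℂ (S i) + finrank ℂ (T i) +
      (if i = x then cnt (n + 1) (Detecting x f n) else 0) = finrank ℂ (cyc ε x f n) := by
    intro i
    by_cases hf : i = f
    · rw [hf, hSf, hTf, if_neg h.ne, finrank_bot, zero_add, add_zero]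
    · rw [hTi i hf, finrank_bot, add_zero]
      by_cases hx : i = x
      · rw [hx, hSx, if_pos rfl, finrank_antiCyc h]
      · rw [hSi i hf hx, if_neg hx, add_zero]
  have h3 := Finset.sum_congr (rfl : (Finset.univ : Finset L) = Finset.univ) fun i _ => h2 i
  rw [Finset.sum_add_distrib, Finset.sum_add_distrib, Finset.sum_ite_eq' Finset.univ x,
    if_pos (Finset.mem_univ _), Finset.sum_const, Finset.card_univ, smul_eq_mul] at h3
  rw [← h1, h3]

theorem finrank_cocyc_zero {ε : L → ℂ} {x f : L} (h : Signs ε x f) :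
    finrank ℂ (cocyc ε x f 0) = Fintype.card L - 1 := by
  have h1 := finrank_cocyc h 0
  have h2 := cnt_detecting x f h.ne 0
  have h3 := cnt_good_head x f h.ne 0
  rw [finrank_cyc_zero h, cnt_good x f h.ne] at h1
  rw [cnt_good x f h.ne] at h3
  have h4 : cnt 0 (fun w => Good x f w ∧ w.head? = some x) = 0 := by simp [cnt]
  simp at h1 h2 h3
  omega

/-- This is dim H^{n+1} = dim Z^{n+1} - (dim C^n - dim Z^n), written without subtraction. The
unknown dimensions of cycles cancel through `finrank_cyc_succ`. -/
theorem finrank_cocyc_succ {ε : L → ℂ} {x f : L} (h : Signs ε x f) (n : ℕ) :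
    finrank ℂ (cocyc ε x f (n + 1)) + finrank ℂ (cocyc ε x f n) =
      (Fintype.card L - 1) ^ (n + 2) + (if (n + 1) % 4 = 0 ∨ (n + 1) % 4 = 1 then 0 else 1) +
        finrank ℂ (homs L n) := by
  have a1 := finrank_cocyc h n
  have a2 := finrank_cocyc h (n + 1)
  have b1 := cnt_detecting x f h.ne n
  have b2 := cnt_detecting x f h.ne (n + 1)
  have c2 := cnt_good_head x f h.ne (n + 1)
  have e := congrArg (Fintype.card L * ·) (finrank_cyc_succ h n)
  simp only [mul_add] at e
  rw [cnt_good x f h.ne] at e c2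
  rw [finrank_homs]
  obtain ⟨m, hm⟩ : ∃ m, Fintype.card L = m + 1 :=
    Nat.exists_eq_succ_of_ne_zero (Fintype.card_pos_iff.2 ⟨x⟩).ne'
  have k : Fintype.card L * (Fintype.card L - 1) ^ (n + 1) =
      (Fintype.card L - 1) ^ (n + 2) + (Fintype.card L - 1) ^ (n + 1) := by
    rw [hm, Nat.add_sub_cancel]; ring
  rw [k] at e
  split_ifs at b1 b2 ⊢ <;> omega

end Differential

end WordComplex
end

noncomputable section
namespace TensorCoalg
open WordComplex Module

/-! ### Sums over factorizations of a word -/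

section Splits

variable {A M : Type*} [AddCommMonoid M]

/-- The sum over all factorizations of a word as a concatenation of two words. -/
def splits (w : List A) (G : List A → List A → M) : M :=
  ∑ i ∈ Finset.range (w.length + 1), G (w.take i) (w.drop i)

@[simp] theorem splits_nil (G : List A → List A → M) : splits [] G = G [] [] := by
  simp [splits]

theorem splits_cons (z : A) (w : List A) (G : List A → List A → M) :
    splits (z :: w) G = G [] (z :: w) + splits w (fun u v => G (z :: u) v) := by
  rw [splits, List.length_cons, Finset.sum_range_succ', add_comm]
  rfl

theorem splits_zero (w : List A) : splits w (fun _ _ => (0 : M)) = 0 := by simp [splits]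

theorem splits_add (w : List A) (G H : List A → List A → M) :
    splits w (fun u v => G u v + H u v) = splits w G + splits w H :=
  Finset.sum_add_distrib

theorem splits_congr (w : List A) {G H : List A → List A → M} (h : ∀ u v, G u v = H u v) :
    splits w G = splits w H :=
  congrArg (splits w) (funext₂ h)

theorem splits_sum {ι : Type*} (S : Finset ι) (w : List A) (G : ι → List A → List A → M) :
    ∑ p ∈ S, splits w (G p) = splits w fun u v => ∑ p ∈ S, G p u v :=
  Finset.sum_comm

theorem map_splits {N : Type*} [AddCommMonoid N] {F : Type*} [FunLike F M N]
    [AddMonoidHomClass F M N] (φ : F) (w : List A) (G : List A → List A → M) :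
    φ (splits w G) = splits w fun u v => φ (G u v) :=
  map_sum φ _ _

theorem splits_left_nil (w : List A) (F : List A → M) :
    splits w (fun u v => if u = [] then F v else 0) = F w := by
  cases w with
  | nil => simp
  | cons z w => rw [splits_cons]; simp [splits_zero]

theorem splits_right_nil (w : List A) (F : List A → M) :
    splits w (fun u v => if v = [] then F u else 0) = F w := by
  induction w generalizing F with
  | nil => simp
  | cons z w ih => rw [splits_cons, ih fun u => F (z :: u)]; simp

variable [DecidableEq A]

theorem splits_left_single (x z : A) (w : List A) (F : List A → M) :
    splits (z :: w) (fun u v => if u = [x] then F v else 0) = if z = x then F w else 0 := by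
  rw [splits_cons]
  by_cases hz : z = x
  · simp [hz, splits_left_nil]
  · simp [hz, splits_zero]

theorem splits_right_single (x : A) (w : List A) (F : List A → ℂ) :
    splits w (fun u v => if v = [x] then F u else 0) = rmul x F w := by
  induction w generalizing F with
  | nil => simp
  | cons z w ih =>
    rw [splits_cons, ih fun u => F (z :: u)]
    cases w with
    | nil => simp [rmul_singleton]
    | cons y w => simp [rmul_cons_cons]

theorem splits_splits_anti (x : A) (w : List A) (F : List A → ℂ) :
    splits w (fun u y => splits y fun v t =>
      if (u = [] ∧ t = [x]) ∨ (u = [x] ∧ t = []) then F v else 0) = anti x F w := by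
  cases w with
  | nil => simp [anti_apply]
  | cons z w =>
    rw [splits_cons, anti_apply, ← splits_right_single, add_comm]
    congr 1
    · by_cases hz : z = x
      · subst hz
        simp only [reduceCtorEq, false_and, false_or, List.cons.injEq, true_and, lmul_cons,
          if_true]
        rw [← splits_left_nil w F]
        apply splits_congr
        intro u v
        by_cases hu : u = []
        · simp [hu, splits_right_nil]
        · simp [hu, splits_zero]
      · simp [hz, splits_zero]
    · simp

theorem splits_splits_bd {ε : A → ℂ} {x f : A} (w : List A) (F : List A → ℂ) :
    splits w (fun u y => splits y fun v t =>
      if v = [x, x] then (u.map ε).prod * F (u ++ f :: t) else 0) = bd ε x f F w := by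
  induction w generalizing F with
  | nil => simp
  | cons z w ih =>
    rw [splits_cons, bd_cons, ← ih, add_comm]
    congr 1
    · refine Eq.trans ?_ (map_splits (AddMonoidHom.mulLeft (ε z)) _ _).symm
      apply splits_congr
      intro u y
      rw [map_splits]
      apply splits_congr
      intro v t
      split_ifs <;> simp [mul_assoc]
    · rw [splits_cons]
      by_cases hz : z = x
      · subst hz
        cases w with
        | nil => simp
        | cons y w => simp [splits_left_single]
      · simp [hz, splits_zero]

end Splits

/-! ### Signs, words and coordinates of cochains -/

variable {r s : ℕ} {W : Type*} [AddCommGroup W] [Module ℂ W]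

/-- The sign `(-1)^{|z|}` of a letter. -/
def letterSign (z : Fin r ⊕ Fin s) : ℂ := sign 1 (letterParity z)

theorem sign_add (p q t : ZMod 2) : sign p (q + t) = sign p q * sign p t := by
  have h : ∀ p : ZMod 2, p = 0 ∨ p = 1 := by decide
  have h0 : (0 : ZMod 2).val = 0 := rfl
  have h1 : (1 : ZMod 2).val = 1 := rfl
  have h2 : (1 + 1 : ZMod 2) = 0 := rfl
  rcases h p with rfl | rfl <;> rcases h q with rfl | rfl <;> rcases h t with rfl | rfl <;>
    simp [sign, h0, h1, h2]

@[simp] theorem sign_zero_right (p : ZMod 2) : sign p 0 = 1 := by simp [sign]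

theorem sign_one_one : sign 1 1 = -1 := by
  have : (1 : ZMod 2).val = 1 := rfl
  simp [sign, this]

theorem sign_mul_self (p q : ZMod 2) : sign p q * sign p q = 1 := by
  rw [← sign_add, CharTwo.add_self_eq_zero, sign_zero_right]

@[simp] theorem wordParity_nil : wordParity ([] : List (Fin r ⊕ Fin s)) = 0 := rfl

@[simp] theorem wordParity_cons (z : Fin r ⊕ Fin s) (w : List (Fin r ⊕ Fin s)) :
    wordParity (z :: w) = letterParity z + wordParity w := by simp [wordParity]

theorem sign_wordParity (w : List (Fin r ⊕ Fin s)) :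
    sign 1 (wordParity w) = (w.map letterSign).prod := by
  induction w with
  | nil => simp
  | cons z w ih => rw [wordParity_cons, sign_add, ih]; rfl

theorem signs_letterSign {x f : Fin r ⊕ Fin s} (hx : letterParity x = 0)
    (hf : letterParity f = 1) : Signs letterSign x f where
  sq z := sign_mul_self 1 _
  even := by simp [letterSign, hx]
  odd := by rw [letterSign, hf, sign_one_one]

variable (b : Module.Basis (Fin r ⊕ Fin s) ℂ W)

theorem word_eq_prod (w : List (Fin r ⊕ Fin s)) :
    word b w = (w.map fun z => TensorAlgebra.ι ℂ (b z)).prod := by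
  simp only [word, Module.Basis.tensorAlgebra, Module.Basis.map_apply,
    FreeAlgebra.basisFreeMonoid, Finsupp.coe_basisSingleOne]
  simp only [TensorAlgebra.equivFreeAlgebra, FreeAlgebra.equivMonoidAlgebraFreeMonoid]
  simp [map_list_prod, Function.comp_def]

theorem word_nil : word b [] = 1 := by simp [word_eq_prod]

theorem word_append (u v : List (Fin r ⊕ Fin s)) : word b (u ++ v) = word b u * word b v := by
  simp [word_eq_prod]

theorem word_cons (z : Fin r ⊕ Fin s) (w : List (Fin r ⊕ Fin s)) :
    word b (z :: w) = TensorAlgebra.ι ℂ (b z) * word b w := by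
  simp [word_eq_prod]


/-- The coefficient functions of a cochain with respect to the basis. -/
def coef : Cochain W ≃ₗ[ℂ] (Fin r ⊕ Fin s → List (Fin r ⊕ Fin s) → ℂ) where
  toFun φ i w := b.repr (φ (word b w)) i
  invFun a := onWords b fun w => ∑ i, a i w • b i
  map_add' φ ψ := by funext i w; simp
  map_smul' c φ := by funext i w; simp
  left_inv φ := ext_words b fun w => by rw [onWords_word]; exact b.sum_repr _
  right_inv a := by
    funext i w
    change b.repr (onWords b _ (word b w)) i = _
    rw [onWords_word]
    exact congrFun (b.repr_sum_self fun i => a i w) i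

theorem coef_apply (φ : Cochain W) (i : Fin r ⊕ Fin s) (w : List (Fin r ⊕ Fin s)) :
    coef b φ i w = b.repr (φ (word b w)) i := rfl

theorem repr_parityProj (p : ZMod 2) (y : W) (i : Fin r ⊕ Fin s) :
    b.repr (parityProj b p y) i = if letterParity i = p then b.repr y i else 0 := by
  have : b.coord i ∘ₗ parityProj b p = if letterParity i = p then b.coord i else 0 := by
    apply b.ext
    intro j
    simp only [LinearMap.comp_apply, parityProj, Basis.constr_basis]
    by_cases hij : i = j
    · subst hij
      split_ifs <;> simp
    · split_ifs <;> simp [Ne.symm hij]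
  have h := LinearMap.congr_fun this y
  simp only [LinearMap.comp_apply, Basis.coord_apply] at h
  rw [h]
  split_ifs <;> rfl

theorem coef_component (p : ZMod 2) (φ : Cochain W) (i : Fin r ⊕ Fin s)
    (w : List (Fin r ⊕ Fin s)) :
    coef b (component b p φ) i w =
      if letterParity i = p + wordParity w then coef b φ i w else 0 := by
  change b.repr (onWords b (fun w => parityProj b (p + wordParity w) (φ (word b w)))
    (word b w)) i = _
  rw [onWords_word, repr_parityProj]
  rfl

theorem sum_smul_component (c : ZMod 2 → ℂ) (φ : Cochain W) (i : Fin r ⊕ Fin s)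
    (w : List (Fin r ⊕ Fin s)) : coef b (∑ p, c p • component b p φ) i w =
      c (letterParity i + wordParity w) * coef b φ i w := by
  simp only [map_sum, map_smul, Finset.sum_apply, Pi.smul_apply, coef_component, smul_eq_mul]
  rw [Finset.sum_eq_single (letterParity i + wordParity w)]
  · rw [if_pos]
    rw [add_assoc, CharTwo.add_self_eq_zero, add_zero]
  · intro p _ hp
    rw [if_neg, mul_zero]
    intro h
    apply hp
    rw [h, add_assoc, CharTwo.add_self_eq_zero, add_zero]
  · simp

theorem sum_component (φ : Cochain W) : ∑ p, component b p φ = φ := by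
  apply (coef b).injective
  funext i w
  have := sum_smul_component b (fun _ => 1) φ i w
  simpa using this

/-- The coefficient of the letter i at w belongs to the component of parity |i| + |w|, so the sign
(-1)^{|φ|} is the product of the signs of i and w. -/
theorem sum_sign_component (φ : Cochain W) (i : Fin r ⊕ Fin s) :
    coef b (∑ p, sign 1 p • component b p φ) i =
      letterSign i • twist letterSign (coef b φ i) := by
  funext w
  rw [sum_smul_component, sign_add, sign_wordParity, mul_assoc]
  rfl

theorem coderivation_word (φ : Cochain W) (w : List (Fin r ⊕ Fin s)) :
    coderivation b φ (word b w) = ∑ p : ZMod 2, splits w fun u y => splits y fun v t =>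
      sign p (wordParity u) •
        (word b u * TensorAlgebra.ι ℂ (component b p φ (word b v)) * word b t) := by
  have h : coderivation b φ = onWords b fun w => ∑ p : ZMod 2,
      ∑ i ∈ Finset.range (w.length + 1), ∑ j ∈ Finset.range (w.length - i + 1),
        sign p (wordParity (w.take i)) • (word b (w.take i) *
          TensorAlgebra.ι ℂ (component b p φ (word b ((w.drop i).take j))) *
          word b (w.drop (i + j))) := rfl
  rw [h, onWords_word]
  simp only [splits, List.length_drop, List.drop_drop]

/-! ### The bracket with d in coordinates -/

variable {x f : Fin r ⊕ Fin s}

theorem coef_basicCochain (I : List (Fin r ⊕ Fin s)) (j i : Fin r ⊕ Fin s)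
    (w : List (Fin r ⊕ Fin s)) :
    coef b (basicCochain b I j) i w = if w = I ∧ i = j then 1 else 0 := by
  rw [coef_apply, basicCochain, onWords_word]
  by_cases hw : w = I
  · simp [hw, Finsupp.single_apply, eq_comm]
  · simp [hw]

theorem component_basicCochain (hx : letterParity x = 0) (hf : letterParity f = 1)
    (p : ZMod 2) : component b p (basicCochain b [x, x] f) =
      if p = 1 then basicCochain b [x, x] f else 0 := by
  apply (coef b).injective
  funext i w
  rw [coef_component, coef_basicCochain]
  by_cases h : w = [x, x] ∧ i = f
  · obtain ⟨rfl, rfl⟩ := h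
    have h1 : letterParity i = p + wordParity [x, x] ↔ p = 1 := by simp [hx, hf, eq_comm]
    rw [if_congr h1 rfl rfl]
    by_cases hp : p = 1
    · simp [hp, coef_basicCochain]
    · simp [hp]
  · rw [if_neg h, ite_self]
    split_ifs
    · rw [coef_basicCochain, if_neg h]
    · simp

theorem coderivation_basicCochain_word (hx : letterParity x = 0) (hf : letterParity f = 1)
    (w : List (Fin r ⊕ Fin s)) : coderivation b (basicCochain b [x, x] f) (word b w) =
      splits w fun u y => splits y fun v t => if v = [x, x] then
        (u.map letterSign).prod • word b (u ++ f :: t) else 0 := by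
  rw [coderivation_word, Finset.sum_eq_single 1]
  · apply splits_congr
    intro u y
    apply splits_congr
    intro v t
    rw [component_basicCochain b hx hf, if_pos rfl, basicCochain, onWords_word, sign_wordParity,
      word_append, word_cons, mul_assoc]
    split_ifs <;> simp
  · intro p _ hp
    simp [component_basicCochain b hx hf, hp, splits_zero]
  · simp

theorem coef_circ_basicCochain (hx : letterParity x = 0) (hf : letterParity f = 1)
    (χ : Cochain W) (i : Fin r ⊕ Fin s) :
    coef b (circ b χ (basicCochain b [x, x] f)) i = bd letterSign x f (coef b χ i) := by
  funext w
  rw [coef_apply, circ, LinearMap.comp_apply, coderivation_basicCochain_word b hx hf,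
    ← splits_splits_bd]
  change (b.coord i ∘ₗ χ) (splits w _) = _
  rw [map_splits]
  apply splits_congr
  intro u y
  rw [map_splits]
  apply splits_congr
  intro v t
  split_ifs
  · simp [coef_apply]
  · simp

theorem basicCochain_mul (u t : List (Fin r ⊕ Fin s)) (y : W) :
    basicCochain b [x, x] f (word b u * TensorAlgebra.ι ℂ y * word b t) =
      if (u = [] ∧ t = [x]) ∨ (u = [x] ∧ t = []) then b.repr y x • b f else 0 := by
  have : basicCochain b [x, x] f ∘ₗ LinearMap.mulRight ℂ (word b t) ∘ₗ
      LinearMap.mulLeft ℂ (word b u) ∘ₗ TensorAlgebra.ι ℂ =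
      if (u = [] ∧ t = [x]) ∨ (u = [x] ∧ t = []) then (b.coord x).smulRight (b f) else 0 := by
    apply b.ext
    intro j
    simp only [LinearMap.comp_apply, LinearMap.mulRight_apply, LinearMap.mulLeft_apply]
    rw [mul_assoc, ← word_cons, ← word_append, basicCochain, onWords_word]
    have h : u ++ j :: t = [x, x] ↔ ((u = [] ∧ t = [x]) ∨ (u = [x] ∧ t = [])) ∧ j = x := by
      rcases u with _ | ⟨y, _ | ⟨z, u⟩⟩
      · simp [and_comm]
      · simp; tauto
      · simp
    by_cases hj : j = x
    · subst hj
      simp only [h, and_true]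
      split_ifs <;> simp
    · simp only [h, hj, and_false, if_false]
      split_ifs <;> simp [hj]
  have h := LinearMap.congr_fun this y
  simp only [LinearMap.comp_apply, LinearMap.mulRight_apply, LinearMap.mulLeft_apply] at h
  rw [h]
  split_ifs <;> rfl

theorem coef_basicCochain_circ (hx : letterParity x = 0) (φ : Cochain W) (i : Fin r ⊕ Fin s) :
    coef b (circ b (basicCochain b [x, x] f) φ) i =
      if i = f then anti x (coef b φ x) else 0 := by
  funext w
  have h1 : coef b φ x = fun v => ∑ p, coef b (component b p φ) x v := by
    conv_lhs => rw [← sum_component b φ]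
    funext v
    simp
  have h2 : basicCochain b [x, x] f (coderivation b φ (word b w)) =
      anti x (coef b φ x) w • b f := by
    rw [coderivation_word, map_sum, ← splits_splits_anti, h1]
    simp only [map_splits]
    rw [splits_sum, ← LinearMap.toSpanSingleton_apply, map_splits]
    apply splits_congr
    intro u y
    rw [splits_sum, map_splits]
    apply splits_congr
    intro v t
    simp only [map_smul, basicCochain_mul]
    split_ifs with h
    -- Only u = [] or u = [x] survives; both are even, so the sign disappears and the parity
    -- components recombine.
    · have h0 : wordParity u = 0 := by
        rcases h with ⟨rfl, -⟩ | ⟨rfl, -⟩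
        · rfl
        · simp [hx]
      simp [h0, coef_apply]
    · simp
  rw [coef_apply, circ, LinearMap.comp_apply, h2]
  by_cases hi : i = f
  · subst hi; simp
  · simp [hi]

theorem bracket_apply (d φ : Cochain W) : bracket b d φ = ∑ p : ZMod 2, ∑ q : ZMod 2,
    (circ b (component b p d) (component b q φ)
      - sign p q • circ b (component b q φ) (component b p d)) := rfl

/-- As d is odd, [d, φ] = d ∘ φ - ((-1)^{|φ|} φ) ∘ d. The minus sign is absorbed by moving `bd` past
`twist`. -/
theorem coef_bracket (hx : letterParity x = 0) (hf : letterParity f = 1) (φ : Cochain W) :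
    coef b (bracket b (basicCochain b [x, x] f) φ) = dif letterSign x f (coef b φ) := by
  have h1 : bracket b (basicCochain b [x, x] f) φ = circ b (basicCochain b [x, x] f) φ -
      circ b (∑ q, sign 1 q • component b q φ) (basicCochain b [x, x] f) := by
    have h2 : circ b (basicCochain b [x, x] f) φ =
        ∑ q, circ b (basicCochain b [x, x] f) (component b q φ) := by
      conv_lhs => rw [← sum_component b φ]
      refine LinearMap.ext fun y => ?_
      simp only [circ, map_sum, LinearMap.comp_apply, LinearMap.sum_apply]
    rw [bracket_apply, Finset.sum_eq_single 1, h2]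
    · refine LinearMap.ext fun y => ?_
      simp only [component_basicCochain b hx hf, if_true, Finset.sum_sub_distrib, circ,
        LinearMap.sub_apply, LinearMap.sum_apply, LinearMap.comp_apply, LinearMap.smul_apply]
    · intro p _ hp
      simp only [component_basicCochain b hx hf, if_neg hp, circ, map_zero, LinearMap.zero_comp,
        LinearMap.comp_zero, smul_zero, sub_zero, Finset.sum_const_zero]
    · simp
  funext i
  rw [h1, map_sub, Pi.sub_apply, coef_basicCochain_circ b hx, coef_circ_basicCochain b hx hf,
    sum_sign_component, map_smul, bd_twist (signs_letterSign hx hf), dif_apply, smul_neg,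
    sub_neg_eq_add, add_comm]

/-! ### The codifferential property -/

theorem comul_word (w : List (Fin r ⊕ Fin s)) :
    comul b (word b w) = splits w fun u v => word b u ⊗ₜ[ℂ] word b v :=
  onWords_word b _ w

theorem coderivation_cons (hx : letterParity x = 0) (hf : letterParity f = 1)
    (z : Fin r ⊕ Fin s) (w : List (Fin r ⊕ Fin s)) :
    coderivation b (basicCochain b [x, x] f) (word b (z :: w)) =
      letterSign z • (TensorAlgebra.ι ℂ (b z) *
        coderivation b (basicCochain b [x, x] f) (word b w)) +
      if z = x then onWords b (fun u => if u.head? = some x then word b (f :: u.tail) else 0)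
        (word b w) else 0 := by
  rw [coderivation_basicCochain_word b hx hf, coderivation_basicCochain_word b hx hf, splits_cons,
    add_comm]
  congr 1
  · change _ = (letterSign z • LinearMap.mulLeft ℂ (TensorAlgebra.ι ℂ (b z))) (splits w _)
    rw [map_splits]
    apply splits_congr
    intro u y
    rw [map_splits]
    apply splits_congr
    intro v t
    split_ifs
    · simp only [map_smul, LinearMap.smul_apply, LinearMap.mulLeft_apply, List.map_cons,
        List.prod_cons, List.cons_append, word_cons, mul_smul, smul_comm (letterSign z)]
    · simp
  · rw [splits_cons, onWords_word]
    by_cases hz : z = x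
    · subst hz
      cases w with
      | nil => simp
      | cons y w => simp [splits_left_single]
    · simp [hz, splits_zero]

theorem comul_mul (z : Fin r ⊕ Fin s) (y : TensorAlgebra ℂ W) :
    comul b (TensorAlgebra.ι ℂ (b z) * y) = 1 ⊗ₜ[ℂ] (TensorAlgebra.ι ℂ (b z) * y) +
      TensorProduct.map (LinearMap.mulLeft ℂ (TensorAlgebra.ι ℂ (b z))) LinearMap.id
        (comul b y) := by
  have : comul b ∘ₗ LinearMap.mulLeft ℂ (TensorAlgebra.ι ℂ (b z)) =
      TensorProduct.mk ℂ (TensorAlgebra ℂ W) (TensorAlgebra ℂ W) 1 ∘ₗ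
        LinearMap.mulLeft ℂ (TensorAlgebra.ι ℂ (b z)) +
      TensorProduct.map (LinearMap.mulLeft ℂ (TensorAlgebra.ι ℂ (b z))) LinearMap.id ∘ₗ
        comul b := by
    apply ext_words b
    intro w
    simp only [LinearMap.comp_apply, LinearMap.mulLeft_apply, LinearMap.add_apply,
      TensorProduct.mk_apply]
    rw [← word_cons, comul_word, comul_word, splits_cons, word_nil, map_splits]
    congr 1
    apply splits_congr
    intro u v
    rw [TensorProduct.map_tmul, LinearMap.mulLeft_apply, word_cons, LinearMap.id_apply]
  exact LinearMap.congr_fun this y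

theorem comul_coderivation (hx : letterParity x = 0) (hf : letterParity f = 1) :
    comul b ∘ₗ coderivation b (basicCochain b [x, x] f) =
      (TensorProduct.map (coderivation b (basicCochain b [x, x] f)) LinearMap.id
        + TensorProduct.map (parityInvolution b) (coderivation b (basicCochain b [x, x] f))) ∘ₗ
      comul b := by
  apply ext_words b
  intro w
  have hnil : coderivation b (basicCochain b [x, x] f) (word b []) = 0 := by
    simp [coderivation_basicCochain_word b hx hf]
  have hinv : ∀ w, parityInvolution b (word b w) = (w.map letterSign).prod • word b w := by
    intro w
    rw [parityInvolution, onWords_word, sign_wordParity]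
  rw [LinearMap.comp_apply, LinearMap.comp_apply]
  induction w with
  | nil =>
    rw [hnil, comul_word, splits_nil, LinearMap.add_apply, TensorProduct.map_tmul,
      TensorProduct.map_tmul, hnil]
    simp
  | cons z w ih =>
    set δ := coderivation b (basicCochain b [x, x] f) with hδ
    set Φ : TensorAlgebra ℂ W ⊗[ℂ] TensorAlgebra ℂ W →ₗ[ℂ]
        TensorAlgebra ℂ W ⊗[ℂ] TensorAlgebra ℂ W :=
      TensorProduct.map δ LinearMap.id + TensorProduct.map (parityInvolution b) δ with hΦ
    set Y : TensorAlgebra ℂ W →ₗ[ℂ] TensorAlgebra ℂ W :=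
      onWords b (fun u => if u.head? = some x then word b (f :: u.tail) else 0) with hY
    have hcons : ∀ w, δ (word b (z :: w)) =
        letterSign z • (TensorAlgebra.ι ℂ (b z) * δ (word b w)) +
          if z = x then Y (word b w) else 0 :=
      coderivation_cons b hx hf z
    -- Y turns a leading x into f and kills other words. It thus acts on the left tensor factor
    -- only, apart from the splitting with empty left part.
    have hcomul : comul b (Y (word b w)) = 1 ⊗ₜ[ℂ] Y (word b w) +
        TensorProduct.map Y LinearMap.id (comul b (word b w)) := by
      rw [comul_word, map_splits]
      simp only [TensorProduct.map_tmul, LinearMap.id_apply, hY, onWords_word]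
      cases w with
      | nil => simp
      | cons y w =>
        rw [splits_cons]
        by_cases hy : y = x
        · subst hy
          simp only [List.head?_cons, if_true, List.tail_cons, comul_word]
          rw [splits_cons]
          simp [word_nil]
        · simp [hy, splits_zero]
    have hone : Φ (1 ⊗ₜ[ℂ] word b (z :: w)) = 1 ⊗ₜ[ℂ] δ (word b (z :: w)) := by
      rw [hΦ, LinearMap.add_apply, TensorProduct.map_tmul, TensorProduct.map_tmul, ← word_nil b,
        hnil, hinv, TensorProduct.zero_tmul, zero_add, List.map_nil, List.prod_nil, one_smul]
    have hrec : Φ (TensorProduct.map (LinearMap.mulLeft ℂ (TensorAlgebra.ι ℂ (b z))) LinearMap.id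
          (comul b (word b w))) =
        letterSign z • TensorProduct.map (LinearMap.mulLeft ℂ (TensorAlgebra.ι ℂ (b z)))
          LinearMap.id (Φ (comul b (word b w))) +
        if z = x then TensorProduct.map Y LinearMap.id (comul b (word b w)) else 0 := by
      rw [comul_word]
      simp only [map_splits]
      have h0 : ∀ G : List (Fin r ⊕ Fin s) → List (Fin r ⊕ Fin s) →
          TensorAlgebra ℂ W ⊗[ℂ] TensorAlgebra ℂ W, letterSign z • splits w G =
            splits w fun u v => letterSign z • G u v :=
        fun G => map_splits (LinearMap.lsmul ℂ (TensorAlgebra ℂ W ⊗[ℂ] TensorAlgebra ℂ W)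
          (letterSign z)) w G
      have h1 : (if z = x then splits w fun u v => TensorProduct.map Y LinearMap.id
            (word b u ⊗ₜ[ℂ] word b v) else 0) =
          splits w fun u v => if z = x then TensorProduct.map Y LinearMap.id
            (word b u ⊗ₜ[ℂ] word b v) else 0 := by
        split_ifs
        · rfl
        · rw [splits_zero]
      rw [h0, h1, ← splits_add]
      apply splits_congr
      intro u v
      simp only [hΦ, TensorProduct.map_tmul, LinearMap.add_apply, LinearMap.mulLeft_apply,
        LinearMap.id_apply, ← word_cons, hcons, hinv, map_add, List.map_cons, List.prod_cons]
      rw [TensorProduct.add_tmul, word_cons, mul_smul_comm, smul_add]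
      split_ifs
      · simp only [TensorProduct.smul_tmul', mul_smul]
        abel
      · simp only [TensorProduct.smul_tmul', mul_smul, TensorProduct.zero_tmul, add_zero]
    have hexp : comul b (word b (z :: w)) = 1 ⊗ₜ[ℂ] word b (z :: w) +
        TensorProduct.map (LinearMap.mulLeft ℂ (TensorAlgebra.ι ℂ (b z))) LinearMap.id
          (comul b (word b w)) := by
      rw [word_cons, comul_mul]
    rw [hexp, map_add, hone, hrec, hcons, map_add, map_smul, comul_mul, ih]
    by_cases hz : z = x
    · simp only [if_pos hz]
      rw [hcomul, TensorProduct.tmul_add, TensorProduct.tmul_smul, smul_add]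
      abel
    · simp only [if_neg hz]
      rw [map_zero, add_zero, add_zero, add_zero, TensorProduct.tmul_smul, smul_add]

/-- The values of d are multiples of f, and d vanishes on words containing f, so both compositions
are zero. -/
theorem bracket_basicCochain_self (hx : letterParity x = 0) (hf : letterParity f = 1) :
    bracket b (basicCochain b [x, x] f) (basicCochain b [x, x] f) = 0 := by
  have hne := (signs_letterSign hx hf).ne
  apply (coef b).injective
  rw [coef_bracket b hx hf, map_zero]
  funext i
  rw [dif_apply, bd_eq_zero_of_mem]
  · have : coef b (basicCochain b [x, x] f) x = 0 := by
      funext w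
      rw [coef_basicCochain, if_neg fun h => hne h.2.symm]
      rfl
    rw [this]
    simp
  · intro u hu
    rw [coef_basicCochain, if_neg]
    rintro ⟨rfl, -⟩
    simp [hne] at hu

theorem isCodifferential_basicCochain (hx : letterParity x = 0) (hf : letterParity f = 1) :
    IsCodifferential b (basicCochain b [x, x] f) where
  odd := by rw [component_basicCochain b hx hf, if_pos rfl]
  coderivation := comul_coderivation b hx hf
  bracket_self := bracket_basicCochain_self b hx hf

/-! ### Transport of dimensions to the cohomology -/

theorem map_coef_cochains (n : ℕ) :
    (cochains b n).map (coef b : Cochain W →ₗ[ℂ] _) = homs (Fin r ⊕ Fin s) n := by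
  ext a
  rw [mem_homs]
  constructor
  · rintro ⟨φ, hφ, rfl⟩ i
    rw [mem_hom]
    intro w hw
    simp [coef_apply, hφ w hw]
  · intro ha
    refine ⟨(coef b).symm a, fun w hw => ?_, by simp⟩
    apply b.repr.injective
    ext i
    rw [← coef_apply, LinearEquiv.apply_symm_apply, mem_hom.1 (ha i) w hw]
    simp

theorem map_coef_cocycles (hx : letterParity x = 0) (hf : letterParity f = 1) (n : ℕ) :
    (cocycles b (basicCochain b [x, x] f) n).map (coef b : Cochain W →ₗ[ℂ] _) =
      cocyc letterSign x f n := by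
  rw [cocyc, ← map_coef_cochains b]
  ext a
  constructor
  · rintro ⟨φ, ⟨h1, h2⟩, rfl⟩
    refine ⟨⟨φ, h1, rfl⟩, ?_⟩
    have h2 : bracket b (basicCochain b [x, x] f) φ = 0 := h2
    change dif letterSign x f (coef b φ) = 0
    rw [← coef_bracket b hx hf, h2, map_zero]
  · rintro ⟨⟨φ, h1, rfl⟩, h2⟩
    refine ⟨φ, ⟨h1, ?_⟩, rfl⟩
    have h2 : dif letterSign x f (coef b φ) = 0 := h2
    rw [← coef_bracket b hx hf] at h2
    exact (coef b).map_eq_zero_iff.1 h2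

theorem finrank_cohomology (hx : letterParity x = 0) (hf : letterParity f = 1) (n : ℕ) :
    finrank ℂ (Cohomology b (basicCochain b [x, x] f) n) =
      if n % 4 = 0 ∨ n % 4 = 1 then (r + s - 1) ^ (n + 1) else (r + s - 1) ^ (n + 1) + 1 := by
  have h := signs_letterSign hx hf
  have hfin : ∀ m, FiniteDimensional ℂ (cochains b m) := fun m =>
    have : FiniteDimensional ℂ ((cochains b m).map (coef b : Cochain W →ₗ[ℂ]
        (Fin r ⊕ Fin s → List (Fin r ⊕ Fin s) → ℂ))) := by
      rw [map_coef_cochains]; infer_instance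
    Module.Finite.equiv ((coef b).submoduleMap (cochains b m)).symm
  have hZ : ∀ m, finrank ℂ (cocycles b (basicCochain b [x, x] f) m) =
      finrank ℂ (cocyc letterSign x f m) := fun m => by
    rw [← map_coef_cocycles b hx hf, LinearEquiv.finrank_map_eq]
  have hC : ∀ m, finrank ℂ (cochains b m) = finrank ℂ (homs (Fin r ⊕ Fin s) m) := fun m => by
    rw [← map_coef_cochains b, LinearEquiv.finrank_map_eq]
  have hZfin : FiniteDimensional ℂ (cocycles b (basicCochain b [x, x] f) n) :=
    Submodule.finiteDimensional_inf_left _ _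
  have hle : coboundaries b (basicCochain b [x, x] f) n ≤
      cocycles b (basicCochain b [x, x] f) n := by
    cases n with
    | zero => exact bot_le
    | succ n =>
      rintro _ ⟨φ, hφ, rfl⟩
      have h1 : coef b φ ∈ homs (Fin r ⊕ Fin s) n := by
        rw [← map_coef_cochains b]
        exact ⟨φ, hφ, rfl⟩
      have h2 : dif letterSign x f (coef b φ) ∈ cocyc letterSign x f (n + 1) :=
        ⟨dif_mem_homs _ _ _ h1, dif_dif h _⟩
      rw [← coef_bracket b hx hf, ← map_coef_cocycles b hx hf] at h2
      obtain ⟨ψ, hψ, he⟩ := h2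
      rwa [← (coef b).injective he]
  have hq : finrank ℂ (Cohomology b (basicCochain b [x, x] f) n) + finrank ℂ
      ((coboundaries b (basicCochain b [x, x] f) n).submoduleOf
        (cocycles b (basicCochain b [x, x] f) n)) =
      finrank ℂ (cocycles b (basicCochain b [x, x] f) n) := Submodule.finrank_quotient_add_finrank
    ((coboundaries b (basicCochain b [x, x] f) n).submoduleOf
      (cocycles b (basicCochain b [x, x] f) n))
  rw [(Submodule.submoduleOfEquivOfLe hle).finrank_eq, hZ] at hq
  have hcard : Fintype.card (Fin r ⊕ Fin s) = r + s := by simp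
  cases n with
  | zero =>
    rw [finrank_cocyc_zero h, hcard] at hq
    have h0 : finrank ℂ (coboundaries b (basicCochain b [x, x] f) 0) = 0 := finrank_bot ℂ _
    rw [h0] at hq
    simpa using hq
  | succ n =>
    have h1 := finrank_cocyc_succ h n
    have h2 : finrank ℂ (coboundaries b (basicCochain b [x, x] f) (n + 1)) +
        finrank ℂ (cocycles b (basicCochain b [x, x] f) n) = finrank ℂ (cochains b n) :=
      finrank_map_add_finrank_inf_ker (cochains b n) _
    have h3 : (r + s - 1) ^ (n + 1 + 1) = (r + s - 1) ^ (n + 2) := rfl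
    rw [hZ, hC] at h2
    rw [hcard] at h1
    rw [h3]
    split_ifs at h1 ⊢ <;> omega

end TensorCoalg
end

theorem theorem1 {W : Type*} [AddCommGroup W] [Module ℂ W] (r s : ℕ) (hr : 1 ≤ r) (hs : 1 ≤ s)
    (b : Module.Basis (Fin r ⊕ Fin s) ℂ W) (e₁ fₛ : Fin r ⊕ Fin s) (d : TensorCoalg.Cochain W)
    (he₁ : e₁ = Sum.inl ⟨0, hr⟩) (hfₛ : fₛ = Sum.inr ⟨s - 1, Nat.sub_lt hs Nat.one_pos⟩)
    (hd : d = TensorCoalg.basicCochain b [e₁, e₁] fₛ) :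
    TensorCoalg.IsCodifferential b d ∧
      ∀ n : ℕ, Module.finrank ℂ (TensorCoalg.Cohomology b d n) =
        if n % 4 = 0 ∨ n % 4 = 1 then (r + s - 1) ^ (n + 1) else (r + s - 1) ^ (n + 1) + 1 := by
  have hx : TensorCoalg.letterParity e₁ = 0 := by rw [he₁]; rfl
  have hf : TensorCoalg.letterParity fₛ = 1 := by rw [hfₛ]; rfl
  rw [hd]
  exact ⟨TensorCoalg.isCodifferential_basicCochain b hx hf,
    TensorCoalg.finrank_cohomology b hx hf⟩
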